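/- Conventions. A double category is strict in the vertical direction and is allowed to be weak in the horizontal direction (strict double categories are included); 1v-cells and 1h-cells are its vertical and horizontal 1-cells, and composition is written in diagrammatic order, $u;v$. A vertical strict transformation $\sigma:F\Rightarrow G$ between pseudodouble functors has 1v-cell components $\sigma_A:FA\to GA$, natural in 1v-cells, and 2-cell components $\sigma_f$ at 1h-cells $f$, natural in 2-cells and compatible with horizontal composition and units. An equation between composites of such transformations (equivalently, an identity vertical modification) means equality of all components, at objects and at 1h-cells. Let $\mathbb M$ and $\mathbb D$ be vertically monoidal double categories: each has a tensor pseudodouble functor (written by juxtaposition), a unit pseudodouble functor from the terminal double category ($J$ for $\mathbb M$, $I$ for $\mathbb D$), and invertible vertical strict transformations $\alpha:(AB)C\to A(BC)$, $\lambda:IA\to A$, $\rho:AI\to A$ satisfying the pentagon axiom and the triangle axioms. Let $\Phi_{M,N}:MN\to NM$ be a vertical double braiding on $\mathbb M$, i.e. an invertible vertical strict transformation satisfying the two hexagon axioms. Let $(F,\beta,\nu)$ be a vertical lax action of $\mathbb M$ on $\mathbb D$: a pseudodouble functor $F:\mathbb M\times\mathbb D\to\mathbb D$, written $MA=F(M,A)$,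 and (not necessarily invertible) vertical strict transformations $\beta_{M,N,A}:M(NA)\to(MN)A$, $\nu_A:A\to JA$ such that $$M\beta_{N,P,A};\ \beta_{M,NP,A}=\beta_{M,N,PA};\ \beta_{MN,P,A};\ \alpha_{M,N,P}A,$$ $$\nu_{MA};\ \beta_{J,M,A};\ \lambda_MA=\mathrm{id},\qquad M\nu_A;\ \beta_{M,J,A};\ \rho_MA=\mathrm{id}.$$ Then the following are equivalent. (1) There is a lax monoidal structure on $(F,\beta,\nu)$ with trivial cocycle modifications $\beta^2,\beta^0,\nu^2,\nu^0$. That is, there are vertical strict transformations $F^2_{M,A,N,B}:(MA)(NB)\to(MN)(AB)$ and $F^0=\iota:I\to JI$ which satisfy the associativity law and the two unit laws of a lax monoidal functor $\mathbb M\times\mathbb D\to\mathbb D$, and $$\beta_{M,N,A}\beta_{P,Q,B};\ F^2_{MN,A,PQ,B};\ (M\Phi_{N,P}Q)(AB)=F^2_{M,NA,P,QB};\ (MP)F^2_{N,A,Q,B};\ \beta_{MP,NQ,AB},$$ $$\iota=\iota;\ J\iota;\ \beta_{J,J,I};\ \lambda_JI,\qquad \nu_{AB}=\nu_A\nu_B;\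 F^2_{J,A,J,B};\ \lambda_J(AB),\qquad \iota=\nu_I,$$ where $M\Phi_{N,P}Q:(MN)(PQ)\to(MP)(NQ)$ is understood up to associativity. (2) There is a structure $(s,t,q,c)$ of a bistrong and commutative vertical lax action on $(F,\beta,\nu)$. That is, there are vertical strict transformations (not necessarily invertible) $t^M_{A,B}:A(MB)\to M(AB)$ and $s^M_{A,B}:(MA)B\to M(AB)$ such that * $t$ is a left strength: $\lambda_{MA}=t^M_{I,A};M\lambda_A$; $\ t^M_{AB,C};M\alpha_{A,B,C}=\alpha_{A,B,MC};At^M_{B,C};t^M_{A,BC}$; $\ A\beta_{M,N,B};t^{MN}_{A,B}=t^M_{A,NB};Mt^N_{A,B};\beta_{M,N,AB}$; $\ \nu_{AB}=A\nu_B;t^J_{A,B}$; * $s$ is a right strength: $\rho_{MA}=s^M_{A,I};M\rho_A$; $\ s^M_{A,B}C;s^M_{AB,C};M\alpha_{A,B,C}=\alpha_{MA,B,C};s^M_{A,BC}$; $\ \beta_{M,N,A}B;s^{MN}_{A,B}=s^M_{NA,B};Ms^N_{A,B};\beta_{M,N,AB}$; $\ \nu_{AB}=\nu_AB;s^J_{A,B}$;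 * (bistrength $q$) $\alpha_{A,MB,C};As^M_{B,C};t^M_{A,BC}=t^M_{A,B}C;s^M_{AB,C};M\alpha_{A,B,C}$; * (commutativity $c$) $t^N_{MA,B};Ns^M_{A,B};\beta_{N,M,AB}=s^M_{A,NB};Mt^N_{A,B};\beta_{M,N,AB};\Phi_{M,N}(AB)$. -/

import Mathlib

open CategoryTheory

universe z₁ w₁ v₁ u₁ z₂ w₂ v₂ u₂ z₃ w₃ v₃ u₃ z₄ w₄ v₄ u₄ z w v u

/-- A double category, strict in the vertical direction and possibly weak in the horizontal
direction (a strict double category is one whose horizontal associators and unitors are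
identities).

The objects and vertical 1-cells (1v-cells) form the category `D`; `HHom A B` are the horizontal
1-cells (1h-cells). `Cell f g` is the type of all 2-cells with top edge `f` and bottom edge `g`;
the 1v-cells on its left and right edges are given by `left` and `right`. The 1h-cells and 2-cells
form a category under vertical composition `vcomp`. Horizontal composition of 2-cells is defined
when the right edge of the first is the left edge of the second. All compositions are written in
diagrammatic order. -/
class DoubleCategory (D : Type u) extends Category.{v} D where
  HHom : D → D → Type w
  Cell : ∀ {A B A' B' : D}, HHom A B → HHom A' B' → Type z
  left : ∀ {A B A' B' : D} {f : HHom A B} {g : HHom A' B'}, Cell f g → (A ⟶ A')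
  right : ∀ {A B A' B' : D} {f : HHom A B} {g : HHom A' B'}, Cell f g → (B ⟶ B')
  /-- The identity 2-cell on a 1h-cell. -/
  vid : ∀ {A B : D} (f : HHom A B), Cell f f
  /-- Vertical composition of 2-cells. -/
  vcomp : ∀ {A B A' B' A'' B'' : D} {f : HHom A B} {g : HHom A' B'} {h : HHom A'' B''},
    Cell f g → Cell g h → Cell f h
  left_vid : ∀ {A B : D} (f : HHom A B), left (vid f) = 𝟙 A
  right_vid : ∀ {A B : D} (f : HHom A B), right (vid f) = 𝟙 B
  left_vcomp : ∀ {A B A' B' A'' B'' : D} {f : HHom A B} {g : HHom A' B'} {h : HHom A'' B''}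
    (a : Cell f g) (b : Cell g h), left (vcomp a b) = left a ≫ left b
  right_vcomp : ∀ {A B A' B' A'' B'' : D} {f : HHom A B} {g : HHom A' B'} {h : HHom A'' B''}
    (a : Cell f g) (b : Cell g h), right (vcomp a b) = right a ≫ right b
  vid_vcomp : ∀ {A B A' B' : D} {f : HHom A B} {g : HHom A' B'} (a : Cell f g),
    vcomp (vid f) a = a
  vcomp_vid : ∀ {A B A' B' : D} {f : HHom A B} {g : HHom A' B'} (a : Cell f g),
    vcomp a (vid g) = a
  vcomp_assoc : ∀ {A B A' B' A'' B'' A''' B''' : D} {f : HHom A B} {g : HHom A' B'}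
    {h : HHom A'' B''} {k : HHom A''' B'''} (a : Cell f g) (b : Cell g h) (c : Cell h k),
    vcomp (vcomp a b) c = vcomp a (vcomp b c)
  /-- The identity 1h-cell on an object. -/
  hid : ∀ A : D, HHom A A
  /-- The identity 2-cell on a 1v-cell. -/
  hidCell : ∀ {A A' : D}, (A ⟶ A') → Cell (hid A) (hid A')
  left_hidCell : ∀ {A A' : D} (p : A ⟶ A'), left (hidCell p) = p
  right_hidCell : ∀ {A A' : D} (p : A ⟶ A'), right (hidCell p) = p
  hidCell_id : ∀ A : D, hidCell (𝟙 A) = vid (hid A)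
  hidCell_comp : ∀ {A A' A'' : D} (p : A ⟶ A') (q : A' ⟶ A''),
    hidCell (p ≫ q) = vcomp (hidCell p) (hidCell q)
  /-- Horizontal composition of 1h-cells. -/
  hcomp : ∀ {A B C : D}, HHom A B → HHom B C → HHom A C
  /-- Horizontal composition of 2-cells. -/
  hcompCell : ∀ {A B C A' B' C' : D} {f : HHom A B} {g : HHom B C} {f' : HHom A' B'}
    {g' : HHom B' C'} (a : Cell f f') (b : Cell g g'), right a = left b →
    Cell (hcomp f g) (hcomp f' g')
  left_hcompCell : ∀ {A B C A' B' C' : D} {f : HHom A B} {g : HHom B C} {f' : HHom A' B'}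
    {g' : HHom B' C'} (a : Cell f f') (b : Cell g g') (e : right a = left b),
    left (hcompCell a b e) = left a
  right_hcompCell : ∀ {A B C A' B' C' : D} {f : HHom A B} {g : HHom B C} {f' : HHom A' B'}
    {g' : HHom B' C'} (a : Cell f f') (b : Cell g g') (e : right a = left b),
    right (hcompCell a b e) = right b
  hcompCell_vid : ∀ {A B C : D} (f : HHom A B) (g : HHom B C)
    (e : right (vid f) = left (vid g)), hcompCell (vid f) (vid g) e = vid (hcomp f g)
  interchange : ∀ {A B C A' B' C' A'' B'' C'' : D} {f : HHom A B} {g : HHom B C}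
    {f' : HHom A' B'} {g' : HHom B' C'} {f'' : HHom A'' B''} {g'' : HHom B'' C''}
    (a : Cell f f') (b : Cell g g') (a' : Cell f' f'') (b' : Cell g' g'')
    (e : right a = left b) (e' : right a' = left b')
    (e'' : right (vcomp a a') = left (vcomp b b')),
    hcompCell (vcomp a a') (vcomp b b') e'' = vcomp (hcompCell a b e) (hcompCell a' b' e')
  /-- The horizontal associator, an invertible horizontally globular 2-cell. -/
  hassoc : ∀ {A B C E : D} (f : HHom A B) (g : HHom B C) (h : HHom C E),
    Cell (hcomp (hcomp f g) h) (hcomp f (hcomp g h))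
  hassocInv : ∀ {A B C E : D} (f : HHom A B) (g : HHom B C) (h : HHom C E),
    Cell (hcomp f (hcomp g h)) (hcomp (hcomp f g) h)
  left_hassoc : ∀ {A B C E : D} (f : HHom A B) (g : HHom B C) (h : HHom C E),
    left (hassoc f g h) = 𝟙 A
  right_hassoc : ∀ {A B C E : D} (f : HHom A B) (g : HHom B C) (h : HHom C E),
    right (hassoc f g h) = 𝟙 E
  hassoc_hom_inv : ∀ {A B C E : D} (f : HHom A B) (g : HHom B C) (h : HHom C E),
    vcomp (hassoc f g h) (hassocInv f g h) = vid _
  hassoc_inv_hom : ∀ {A B C E : D} (f : HHom A B) (g : HHom B C) (h : HHom C E),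
    vcomp (hassocInv f g h) (hassoc f g h) = vid _
  hassoc_naturality : ∀ {A B C E A' B' C' E' : D} {f : HHom A B} {g : HHom B C} {h : HHom C E}
    {f' : HHom A' B'} {g' : HHom B' C'} {h' : HHom C' E'}
    (a : Cell f f') (b : Cell g g') (c : Cell h h') (e : right a = left b) (e' : right b = left c)
    (e₁ : right (hcompCell a b e) = left c) (e₂ : right a = left (hcompCell b c e')),
    vcomp (hcompCell (hcompCell a b e) c e₁) (hassoc f' g' h') =
      vcomp (hassoc f g h) (hcompCell a (hcompCell b c e') e₂)
  /-- The horizontal unitors, invertible horizontally globular 2-cells. -/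
  hleft : ∀ {A B : D} (f : HHom A B), Cell (hcomp (hid A) f) f
  hleftInv : ∀ {A B : D} (f : HHom A B), Cell f (hcomp (hid A) f)
  left_hleft : ∀ {A B : D} (f : HHom A B), left (hleft f) = 𝟙 A
  right_hleft : ∀ {A B : D} (f : HHom A B), right (hleft f) = 𝟙 B
  hleft_hom_inv : ∀ {A B : D} (f : HHom A B), vcomp (hleft f) (hleftInv f) = vid _
  hleft_inv_hom : ∀ {A B : D} (f : HHom A B), vcomp (hleftInv f) (hleft f) = vid _
  hleft_naturality : ∀ {A B A' B' : D} {f : HHom A B} {g : HHom A' B'} (a : Cell f g)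
    (e : right (hidCell (left a)) = left a),
    vcomp (hcompCell (hidCell (left a)) a e) (hleft g) = vcomp (hleft f) a
  hright : ∀ {A B : D} (f : HHom A B), Cell (hcomp f (hid B)) f
  hrightInv : ∀ {A B : D} (f : HHom A B), Cell f (hcomp f (hid B))
  left_hright : ∀ {A B : D} (f : HHom A B), left (hright f) = 𝟙 A
  right_hright : ∀ {A B : D} (f : HHom A B), right (hright f) = 𝟙 B
  hright_hom_inv : ∀ {A B : D} (f : HHom A B), vcomp (hright f) (hrightInv f) = vid _
  hright_inv_hom : ∀ {A B : D} (f : HHom A B), vcomp (hrightInv f) (hright f) = vid _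
  hright_naturality : ∀ {A B A' B' : D} {f : HHom A B} {g : HHom A' B'} (a : Cell f g)
    (e : right a = left (hidCell (right a))),
    vcomp (hcompCell a (hidCell (right a)) e) (hright g) = vcomp (hright f) a
  hpentagon : ∀ {A B C E G : D} (f : HHom A B) (g : HHom B C) (h : HHom C E) (k : HHom E G)
    (e₁ : right (hassoc f g h) = left (vid k)) (e₂ : right (vid f) = left (hassoc g h k)),
    vcomp (vcomp (hcompCell (hassoc f g h) (vid k) e₁) (hassoc f (hcomp g h) k))
        (hcompCell (vid f) (hassoc g h k) e₂) =
      vcomp (hassoc (hcomp f g) h k) (hassoc f g (hcomp h k))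
  htriangle : ∀ {A B C : D} (f : HHom A B) (g : HHom B C)
    (e₁ : right (vid f) = left (hleft g)) (e₂ : right (hright f) = left (vid g)),
    vcomp (hassoc f (hid B) g) (hcompCell (vid f) (hleft g) e₁) =
      hcompCell (hright f) (vid g) e₂

namespace DoubleCategory

attribute [simp] left_vid right_vid left_vcomp right_vcomp vid_vcomp vcomp_vid vcomp_assoc
  left_hidCell right_hidCell hidCell_id left_hcompCell right_hcompCell hcompCell_vid
  left_hassoc right_hassoc hassoc_hom_inv hassoc_inv_hom left_hleft right_hleft hleft_hom_inv
  hleft_inv_hom left_hright right_hright hright_hom_inv hright_inv_hom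

end DoubleCategory

open DoubleCategory

/-- Vertical composition of 2-cells, the first one on top. -/
infixr:80 " ≫ᵥ " => DoubleCategory.vcomp

/-- The product of two double categories. -/
instance DoubleCategory.instProd (C : Type u₁) [DoubleCategory.{z₁, w₁, v₁, u₁} C] (D : Type u₂)
    [DoubleCategory.{z₂, w₂, v₂, u₂} D] :
    DoubleCategory.{max z₁ z₂, max w₁ w₂, max v₁ v₂, max u₁ u₂} (C × D) where
  toCategory := CategoryTheory.prod' C D
  HHom X Y := HHom X.1 Y.1 × HHom X.2 Y.2
  Cell f g := Cell f.1 g.1 × Cell f.2 g.2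
  left a := (left a.1, left a.2)
  right a := (right a.1, right a.2)
  vid f := (vid f.1, vid f.2)
  vcomp a b := (a.1 ≫ᵥ b.1, a.2 ≫ᵥ b.2)
  left_vid _ := by ext <;> simp
  right_vid _ := by ext <;> simp
  left_vcomp _ _ := by ext <;> simp
  right_vcomp _ _ := by ext <;> simp
  vid_vcomp _ := by simp
  vcomp_vid _ := by simp
  vcomp_assoc _ _ _ := by simp
  hid X := (hid X.1, hid X.2)
  hidCell p := (hidCell p.1, hidCell p.2)
  left_hidCell _ := by ext <;> simp
  right_hidCell _ := by ext <;> simp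
  hidCell_id _ := by ext <;> simp
  hidCell_comp _ _ := by ext <;> simp [hidCell_comp]
  hcomp f g := (hcomp f.1 g.1, hcomp f.2 g.2)
  hcompCell a b e :=
    (hcompCell a.1 b.1 (congrArg Prod.fst e), hcompCell a.2 b.2 (congrArg Prod.snd e))
  left_hcompCell _ _ _ := by ext <;> simp
  right_hcompCell _ _ _ := by ext <;> simp
  hcompCell_vid _ _ _ := by ext <;> simp
  interchange _ _ _ _ _ _ _ := Prod.ext (interchange _ _ _ _ _ _ _) (interchange _ _ _ _ _ _ _)
  hassoc f g h := (hassoc f.1 g.1 h.1, hassoc f.2 g.2 h.2)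
  hassocInv f g h := (hassocInv f.1 g.1 h.1, hassocInv f.2 g.2 h.2)
  left_hassoc _ _ _ := by ext <;> simp
  right_hassoc _ _ _ := by ext <;> simp
  hassoc_hom_inv _ _ _ := by simp
  hassoc_inv_hom _ _ _ := by simp
  hassoc_naturality _ _ _ _ _ _ _ :=
    Prod.ext (hassoc_naturality _ _ _ _ _ _ _) (hassoc_naturality _ _ _ _ _ _ _)
  hleft f := (hleft f.1, hleft f.2)
  hleftInv f := (hleftInv f.1, hleftInv f.2)
  left_hleft _ := by ext <;> simp
  right_hleft _ := by ext <;> simp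
  hleft_hom_inv _ := by simp
  hleft_inv_hom _ := by simp
  hleft_naturality _ _ := Prod.ext (hleft_naturality _ _) (hleft_naturality _ _)
  hright f := (hright f.1, hright f.2)
  hrightInv f := (hrightInv f.1, hrightInv f.2)
  left_hright _ := by ext <;> simp
  right_hright _ := by ext <;> simp
  hright_hom_inv _ := by simp
  hright_inv_hom _ := by simp
  hright_naturality _ _ := Prod.ext (hright_naturality _ _) (hright_naturality _ _)
  hpentagon _ _ _ _ _ _ := Prod.ext (hpentagon _ _ _ _ _ _) (hpentagon _ _ _ _ _ _)
  htriangle _ _ _ _ := Prod.ext (htriangle _ _ _ _) (htriangle _ _ _ _)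

/-- The one-object type underlying the terminal double category. -/
abbrev DPoint : Type := Discrete PUnit.{1}

/-- The terminal double category. -/
instance DoubleCategory.instPoint : DoubleCategory.{0, 0, 0, 0} DPoint where
  toCategory := CategoryTheory.discreteCategory PUnit.{1}
  HHom _ _ := PUnit
  Cell _ _ := PUnit
  left _ := eqToHom (Subsingleton.elim _ _)
  right _ := eqToHom (Subsingleton.elim _ _)
  vid _ := ⟨⟩
  vcomp _ _ := ⟨⟩
  left_vid _ := Subsingleton.elim _ _
  right_vid _ := Subsingleton.elim _ _
  left_vcomp _ _ := Subsingleton.elim _ _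
  right_vcomp _ _ := Subsingleton.elim _ _
  vid_vcomp _ := rfl
  vcomp_vid _ := rfl
  vcomp_assoc _ _ _ := rfl
  hid _ := ⟨⟩
  hidCell _ := ⟨⟩
  left_hidCell _ := Subsingleton.elim _ _
  right_hidCell _ := Subsingleton.elim _ _
  hidCell_id _ := rfl
  hidCell_comp _ _ := rfl
  hcomp _ _ := ⟨⟩
  hcompCell _ _ _ := ⟨⟩
  left_hcompCell _ _ _ := Subsingleton.elim _ _
  right_hcompCell _ _ _ := Subsingleton.elim _ _
  hcompCell_vid _ _ _ := rfl
  interchange _ _ _ _ _ _ _ := rfl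
  hassoc _ _ _ := ⟨⟩
  hassocInv _ _ _ := ⟨⟩
  left_hassoc _ _ _ := Subsingleton.elim _ _
  right_hassoc _ _ _ := Subsingleton.elim _ _
  hassoc_hom_inv _ _ _ := rfl
  hassoc_inv_hom _ _ _ := rfl
  hassoc_naturality _ _ _ _ _ _ _ := rfl
  hleft _ := ⟨⟩
  hleftInv _ := ⟨⟩
  left_hleft _ := Subsingleton.elim _ _
  right_hleft _ := Subsingleton.elim _ _
  hleft_hom_inv _ := rfl
  hleft_inv_hom _ := rfl
  hleft_naturality _ _ := rfl
  hright _ := ⟨⟩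
  hrightInv _ := ⟨⟩
  left_hright _ := Subsingleton.elim _ _
  right_hright _ := Subsingleton.elim _ _
  hright_hom_inv _ := rfl
  hright_inv_hom _ := rfl
  hright_naturality _ _ := rfl
  hpentagon _ _ _ _ _ _ := rfl
  htriangle _ _ _ _ := rfl

/-- A pseudodouble functor: strictly functorial in the vertical direction, and functorial in the
horizontal direction up to the invertible horizontally globular 2-cells `comp` and `unit`. -/
structure PDFunctor (C : Type u₁) [DoubleCategory.{z₁, w₁, v₁, u₁} C] (D : Type u₂)
    [DoubleCategory.{z₂, w₂, v₂, u₂} D] extends C ⥤ D where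
  hmap : ∀ {A B : C}, HHom A B → HHom (obj A) (obj B)
  cmap : ∀ {A B A' B' : C} {f : HHom A B} {g : HHom A' B'}, Cell f g → Cell (hmap f) (hmap g)
  left_cmap : ∀ {A B A' B' : C} {f : HHom A B} {g : HHom A' B'} (a : Cell f g),
    left (cmap a) = map (left a)
  right_cmap : ∀ {A B A' B' : C} {f : HHom A B} {g : HHom A' B'} (a : Cell f g),
    right (cmap a) = map (right a)
  cmap_vid : ∀ {A B : C} (f : HHom A B), cmap (vid f) = vid (hmap f)
  cmap_vcomp : ∀ {A B A' B' A'' B'' : C} {f : HHom A B} {g : HHom A' B'} {h : HHom A'' B''}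
    (a : Cell f g) (b : Cell g h), cmap (a ≫ᵥ b) = cmap a ≫ᵥ cmap b
  comp : ∀ {A B E : C} (f : HHom A B) (g : HHom B E),
    Cell (hcomp (hmap f) (hmap g)) (hmap (hcomp f g))
  compInv : ∀ {A B E : C} (f : HHom A B) (g : HHom B E),
    Cell (hmap (hcomp f g)) (hcomp (hmap f) (hmap g))
  left_comp : ∀ {A B E : C} (f : HHom A B) (g : HHom B E), left (comp f g) = 𝟙 (obj A)
  right_comp : ∀ {A B E : C} (f : HHom A B) (g : HHom B E), right (comp f g) = 𝟙 (obj E)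
  comp_hom_inv : ∀ {A B E : C} (f : HHom A B) (g : HHom B E), comp f g ≫ᵥ compInv f g = vid _
  comp_inv_hom : ∀ {A B E : C} (f : HHom A B) (g : HHom B E), compInv f g ≫ᵥ comp f g = vid _
  comp_naturality : ∀ {A B E A' B' E' : C} {f : HHom A B} {g : HHom B E} {f' : HHom A' B'}
    {g' : HHom B' E'} (a : Cell f f') (b : Cell g g') (e : right a = left b)
    (e' : right (cmap a) = left (cmap b)),
    hcompCell (cmap a) (cmap b) e' ≫ᵥ comp f' g' = comp f g ≫ᵥ cmap (hcompCell a b e)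
  unit : ∀ A : C, Cell (hid (obj A)) (hmap (hid A))
  unitInv : ∀ A : C, Cell (hmap (hid A)) (hid (obj A))
  left_unit : ∀ A : C, left (unit A) = 𝟙 (obj A)
  right_unit : ∀ A : C, right (unit A) = 𝟙 (obj A)
  unit_hom_inv : ∀ A : C, unit A ≫ᵥ unitInv A = vid _
  unit_inv_hom : ∀ A : C, unitInv A ≫ᵥ unit A = vid _
  unit_naturality : ∀ {A A' : C} (p : A ⟶ A'),
    hidCell (map p) ≫ᵥ unit A' = unit A ≫ᵥ cmap (hidCell p)
  comp_assoc : ∀ {A B E G : C} (f : HHom A B) (g : HHom B E) (h : HHom E G)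
    (e₁ : right (comp f g) = left (vid (hmap h))) (e₂ : right (vid (hmap f)) = left (comp g h)),
    hcompCell (comp f g) (vid (hmap h)) e₁ ≫ᵥ comp (hcomp f g) h ≫ᵥ cmap (hassoc f g h) =
      hassoc (hmap f) (hmap g) (hmap h) ≫ᵥ hcompCell (vid (hmap f)) (comp g h) e₂ ≫ᵥ
        comp f (hcomp g h)
  comp_left_unit : ∀ {A B : C} (f : HHom A B) (e : right (unit A) = left (vid (hmap f))),
    hcompCell (unit A) (vid (hmap f)) e ≫ᵥ comp (hid A) f ≫ᵥ cmap (hleft f) = hleft (hmap f)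
  comp_right_unit : ∀ {A B : C} (f : HHom A B) (e : right (vid (hmap f)) = left (unit B)),
    hcompCell (vid (hmap f)) (unit B) e ≫ᵥ comp f (hid B) ≫ᵥ cmap (hright f) = hright (hmap f)

namespace PDFunctor

attribute [simp] left_cmap right_cmap cmap_vid cmap_vcomp left_comp right_comp comp_hom_inv
  comp_inv_hom left_unit right_unit unit_hom_inv unit_inv_hom

section Constructions

variable {B : Type u₁} [DoubleCategory.{z₁, w₁, v₁, u₁} B] {C : Type u₂}
  [DoubleCategory.{z₂, w₂, v₂, u₂} C] {D : Type u₃} [DoubleCategory.{z₃, w₃, v₃, u₃} D]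

/-- The identity pseudodouble functor. -/
def idF (C : Type u₂) [DoubleCategory.{z₂, w₂, v₂, u₂} C] : PDFunctor C C where
  toFunctor := Functor.id C
  hmap f := f
  cmap a := a
  left_cmap _ := rfl
  right_cmap _ := rfl
  cmap_vid _ := rfl
  cmap_vcomp _ _ := rfl
  comp _ _ := vid _
  compInv _ _ := vid _
  left_comp _ _ := by simp
  right_comp _ _ := by simp
  comp_hom_inv _ _ := by simp
  comp_inv_hom _ _ := by simp
  comp_naturality _ _ _ _ := by simp
  unit _ := vid _
  unitInv _ := vid _
  left_unit _ := by simp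
  right_unit _ := by simp
  unit_hom_inv _ := by simp
  unit_inv_hom _ := by simp
  unit_naturality _ := by simp
  comp_assoc _ _ _ _ _ := by simp
  comp_left_unit _ _ := by simp
  comp_right_unit _ _ := by simp

/-- The composite pseudodouble functor, first `F` and then `G`. -/
def compF (F : PDFunctor B C) (G : PDFunctor C D) : PDFunctor B D where
  toFunctor := F.toFunctor ⋙ G.toFunctor
  hmap f := G.hmap (F.hmap f)
  cmap a := G.cmap (F.cmap a)
  left_cmap _ := by simp
  right_cmap _ := by simp
  cmap_vid _ := by simp
  cmap_vcomp _ _ := by simp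
  comp f g := G.comp (F.hmap f) (F.hmap g) ≫ᵥ G.cmap (F.comp f g)
  compInv f g := G.cmap (F.compInv f g) ≫ᵥ G.compInv (F.hmap f) (F.hmap g)
  left_comp _ _ := by simp
  right_comp _ _ := by simp
  comp_hom_inv f g := by
    rw [vcomp_assoc, ← vcomp_assoc (G.cmap _) (G.cmap _), ← G.cmap_vcomp]; simp
  comp_inv_hom f g := by
    rw [vcomp_assoc, ← vcomp_assoc (G.compInv _ _) (G.comp _ _)]
    simp [← G.cmap_vcomp]
  comp_naturality {_ _ _ _ _ _ f g f' g'} a b e e' := by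
    have e₀ : right (F.cmap a) = left (F.cmap b) := by simp [e]
    rw [← vcomp_assoc, G.comp_naturality (F.cmap a) (F.cmap b) e₀, vcomp_assoc, ← G.cmap_vcomp,
      F.comp_naturality a b e e₀, G.cmap_vcomp, vcomp_assoc]
  unit A := G.unit (F.obj A) ≫ᵥ G.cmap (F.unit A)
  unitInv A := G.cmap (F.unitInv A) ≫ᵥ G.unitInv (F.obj A)
  left_unit _ := by simp
  right_unit _ := by simp
  unit_hom_inv A := by
    rw [vcomp_assoc, ← vcomp_assoc (G.cmap _) (G.cmap _), ← G.cmap_vcomp]; simp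
  unit_inv_hom A := by
    rw [vcomp_assoc, ← vcomp_assoc (G.unitInv _) (G.unit _)]
    simp [← G.cmap_vcomp]
  unit_naturality p := by
    change hidCell (G.map (F.map p)) ≫ᵥ _ = _
    rw [← vcomp_assoc, G.unit_naturality, vcomp_assoc, ← G.cmap_vcomp, F.unit_naturality,
      G.cmap_vcomp, vcomp_assoc]
  comp_assoc f g h e₁ e₂ := by
    have h₁ : right (G.comp (F.hmap f) (F.hmap g)) = left (vid (G.hmap (F.hmap h))) := by simp
    have h₂ : right (G.cmap (F.comp f g)) = left (G.cmap (vid (F.hmap h))) := by simp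
    have h₃ : right (F.comp f g) = left (vid (F.hmap h)) := by simp
    have h₄ : right (vid (G.hmap (F.hmap f))) = left (G.comp (F.hmap g) (F.hmap h)) := by simp
    have h₅ : right (G.cmap (vid (F.hmap f))) = left (G.cmap (F.comp g h)) := by simp
    have h₆ : right (vid (F.hmap f)) = left (F.comp g h) := by simp
    have k₁ : hcompCell (G.comp (F.hmap f) (F.hmap g) ≫ᵥ G.cmap (F.comp f g))
        (vid (G.hmap (F.hmap h))) e₁ =
        hcompCell (G.comp (F.hmap f) (F.hmap g)) (vid (G.hmap (F.hmap h))) h₁ ≫ᵥ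
          hcompCell (G.cmap (F.comp f g)) (G.cmap (vid (F.hmap h))) h₂ := by
      rw [← interchange _ _ _ _ h₁ h₂ (by simp)]
      congr 1
      simp
    have k₂ : hcompCell (vid (G.hmap (F.hmap f)))
        (G.comp (F.hmap g) (F.hmap h) ≫ᵥ G.cmap (F.comp g h)) e₂ =
        hcompCell (vid (G.hmap (F.hmap f))) (G.comp (F.hmap g) (F.hmap h)) h₄ ≫ᵥ
          hcompCell (G.cmap (vid (F.hmap f))) (G.cmap (F.comp g h)) h₅ := by
      rw [← interchange _ _ _ _ h₄ h₅ (by simp)]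
      congr 1
      simp
    have k₃ := G.comp_naturality (F.comp f g) (vid (F.hmap h)) h₃ h₂
    have k₄ := G.comp_naturality (vid (F.hmap f)) (F.comp g h) h₆ h₅
    have k₅ := congrArg G.cmap (F.comp_assoc f g h h₃ h₆)
    have k₆ := G.comp_assoc (F.hmap f) (F.hmap g) (F.hmap h) h₁ h₄
    simp only [G.cmap_vcomp] at k₅
    rw [k₁, k₂]
    simp only [vcomp_assoc]
    rw [← vcomp_assoc _ _ (G.cmap (F.comp (hcomp f g) h) ≫ᵥ _), k₃, vcomp_assoc, k₅]
    have k₄' := congrArg (fun x => x ≫ᵥ G.cmap (F.comp f (hcomp g h))) k₄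
    have k₆' := congrArg (fun x => x ≫ᵥ G.cmap (hcompCell (vid (F.hmap f)) (F.comp g h) h₆) ≫ᵥ
      G.cmap (F.comp f (hcomp g h))) k₆
    simp only [vcomp_assoc] at k₄' k₆'
    rw [k₄', k₆']
  comp_left_unit f e := by
    have h₁ : right (G.unit (F.obj _)) = left (vid (G.hmap (F.hmap f))) := by simp
    have h₂ : right (G.cmap (F.unit _)) = left (G.cmap (vid (F.hmap f))) := by simp
    have h₃ : right (F.unit _) = left (vid (F.hmap f)) := by simp
    have k₁ : hcompCell (G.unit (F.obj _) ≫ᵥ G.cmap (F.unit _)) (vid (G.hmap (F.hmap f))) e =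
        hcompCell (G.unit (F.obj _)) (vid (G.hmap (F.hmap f))) h₁ ≫ᵥ
          hcompCell (G.cmap (F.unit _)) (G.cmap (vid (F.hmap f))) h₂ := by
      rw [← interchange _ _ _ _ h₁ h₂ (by simp)]
      congr 1
      simp
    have k₂ := G.comp_naturality (F.unit _) (vid (F.hmap f)) h₃ h₂
    have k₃ := congrArg G.cmap (F.comp_left_unit f h₃)
    simp only [G.cmap_vcomp] at k₃
    rw [k₁]
    simp only [vcomp_assoc]
    rw [← vcomp_assoc _ _ (G.cmap (F.comp _ f) ≫ᵥ _), k₂, vcomp_assoc, k₃, G.comp_left_unit]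
  comp_right_unit f e := by
    have h₁ : right (vid (G.hmap (F.hmap f))) = left (G.unit (F.obj _)) := by simp
    have h₂ : right (G.cmap (vid (F.hmap f))) = left (G.cmap (F.unit _)) := by simp
    have h₃ : right (vid (F.hmap f)) = left (F.unit _) := by simp
    have k₁ : hcompCell (vid (G.hmap (F.hmap f))) (G.unit (F.obj _) ≫ᵥ G.cmap (F.unit _)) e =
        hcompCell (vid (G.hmap (F.hmap f))) (G.unit (F.obj _)) h₁ ≫ᵥ
          hcompCell (G.cmap (vid (F.hmap f))) (G.cmap (F.unit _)) h₂ := by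
      rw [← interchange _ _ _ _ h₁ h₂ (by simp)]
      congr 1
      simp
    have k₂ := G.comp_naturality (vid (F.hmap f)) (F.unit _) h₃ h₂
    have k₃ := congrArg G.cmap (F.comp_right_unit f h₃)
    simp only [G.cmap_vcomp] at k₃
    rw [k₁]
    simp only [vcomp_assoc]
    rw [← vcomp_assoc _ _ (G.cmap (F.comp f _) ≫ᵥ _), k₂, vcomp_assoc, k₃, G.comp_right_unit]

/-- The pseudodouble functor into a product with the given components. -/
def pair (F : PDFunctor B C) (G : PDFunctor B D) : PDFunctor B (C × D) where
  toFunctor := F.toFunctor.prod' G.toFunctor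
  hmap f := (F.hmap f, G.hmap f)
  cmap a := (F.cmap a, G.cmap a)
  left_cmap a := Prod.ext (F.left_cmap a) (G.left_cmap a)
  right_cmap a := Prod.ext (F.right_cmap a) (G.right_cmap a)
  cmap_vid f := Prod.ext (F.cmap_vid f) (G.cmap_vid f)
  cmap_vcomp a b := Prod.ext (F.cmap_vcomp a b) (G.cmap_vcomp a b)
  comp f g := (F.comp f g, G.comp f g)
  compInv f g := (F.compInv f g, G.compInv f g)
  left_comp f g := Prod.ext (F.left_comp f g) (G.left_comp f g)
  right_comp f g := Prod.ext (F.right_comp f g) (G.right_comp f g)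
  comp_hom_inv f g := Prod.ext (F.comp_hom_inv f g) (G.comp_hom_inv f g)
  comp_inv_hom f g := Prod.ext (F.comp_inv_hom f g) (G.comp_inv_hom f g)
  comp_naturality a b e e' :=
    Prod.ext (F.comp_naturality a b e (congrArg Prod.fst e'))
      (G.comp_naturality a b e (congrArg Prod.snd e'))
  unit A := (F.unit A, G.unit A)
  unitInv A := (F.unitInv A, G.unitInv A)
  left_unit A := Prod.ext (F.left_unit A) (G.left_unit A)
  right_unit A := Prod.ext (F.right_unit A) (G.right_unit A)
  unit_hom_inv A := Prod.ext (F.unit_hom_inv A) (G.unit_hom_inv A)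
  unit_inv_hom A := Prod.ext (F.unit_inv_hom A) (G.unit_inv_hom A)
  unit_naturality p := Prod.ext (F.unit_naturality p) (G.unit_naturality p)
  comp_assoc f g h e₁ e₂ :=
    Prod.ext (F.comp_assoc f g h (congrArg Prod.fst e₁) (congrArg Prod.fst e₂))
      (G.comp_assoc f g h (congrArg Prod.snd e₁) (congrArg Prod.snd e₂))
  comp_left_unit f e :=
    Prod.ext (F.comp_left_unit f (congrArg Prod.fst e)) (G.comp_left_unit f (congrArg Prod.snd e))
  comp_right_unit f e :=
    Prod.ext (F.comp_right_unit f (congrArg Prod.fst e))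
      (G.comp_right_unit f (congrArg Prod.snd e))

/-- The first projection pseudodouble functor of a product. -/
def fstF (C : Type u₂) [DoubleCategory.{z₂, w₂, v₂, u₂} C] (D : Type u₃)
    [DoubleCategory.{z₃, w₃, v₃, u₃} D] : PDFunctor (C × D) C where
  toFunctor := CategoryTheory.Prod.fst C D
  hmap f := f.1
  cmap a := a.1
  left_cmap _ := rfl
  right_cmap _ := rfl
  cmap_vid _ := rfl
  cmap_vcomp _ _ := rfl
  comp _ _ := vid _
  compInv _ _ := vid _
  left_comp _ _ := by simp
  right_comp _ _ := by simp
  comp_hom_inv _ _ := by simp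
  comp_inv_hom _ _ := by simp
  comp_naturality _ _ _ _ := (vcomp_vid _).trans (vid_vcomp _).symm
  unit _ := vid _
  unitInv _ := vid _
  left_unit _ := by simp
  right_unit _ := by simp
  unit_hom_inv _ := by simp
  unit_inv_hom _ := by simp
  unit_naturality _ := (vcomp_vid _).trans (vid_vcomp _).symm
  comp_assoc f g h _ _ := by
    rw [hcompCell_vid, hcompCell_vid, vid_vcomp, vid_vcomp, vid_vcomp]
    exact (vcomp_vid _).symm
  comp_left_unit f _ := by
    rw [vid_vcomp, hcompCell_vid]
    exact vid_vcomp _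
  comp_right_unit f _ := by
    rw [vid_vcomp, hcompCell_vid]
    exact vid_vcomp _

/-- The second projection pseudodouble functor of a product. -/
def sndF (C : Type u₂) [DoubleCategory.{z₂, w₂, v₂, u₂} C] (D : Type u₃)
    [DoubleCategory.{z₃, w₃, v₃, u₃} D] : PDFunctor (C × D) D where
  toFunctor := CategoryTheory.Prod.snd C D
  hmap f := f.2
  cmap a := a.2
  left_cmap _ := rfl
  right_cmap _ := rfl
  cmap_vid _ := rfl
  cmap_vcomp _ _ := rfl
  comp _ _ := vid _
  compInv _ _ := vid _
  left_comp _ _ := by simp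
  right_comp _ _ := by simp
  comp_hom_inv _ _ := by simp
  comp_inv_hom _ _ := by simp
  comp_naturality _ _ _ _ := (vcomp_vid _).trans (vid_vcomp _).symm
  unit _ := vid _
  unitInv _ := vid _
  left_unit _ := by simp
  right_unit _ := by simp
  unit_hom_inv _ := by simp
  unit_inv_hom _ := by simp
  unit_naturality _ := (vcomp_vid _).trans (vid_vcomp _).symm
  comp_assoc f g h _ _ := by
    rw [hcompCell_vid, hcompCell_vid, vid_vcomp, vid_vcomp, vid_vcomp]
    exact (vcomp_vid _).symm
  comp_left_unit f _ := by
    rw [vid_vcomp, hcompCell_vid]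
    exact vid_vcomp _
  comp_right_unit f _ := by
    rw [vid_vcomp, hcompCell_vid]
    exact vid_vcomp _

/-- The unique pseudodouble functor to the terminal double category. -/
def toPoint (C : Type u₂) [DoubleCategory.{z₂, w₂, v₂, u₂} C] : PDFunctor C DPoint where
  toFunctor := (Functor.const C).obj ⟨⟨⟩⟩
  hmap _ := ⟨⟩
  cmap _ := ⟨⟩
  left_cmap _ := Subsingleton.elim _ _
  right_cmap _ := Subsingleton.elim _ _
  cmap_vid _ := rfl
  cmap_vcomp _ _ := rfl
  comp _ _ := ⟨⟩
  compInv _ _ := ⟨⟩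
  left_comp _ _ := Subsingleton.elim _ _
  right_comp _ _ := Subsingleton.elim _ _
  comp_hom_inv _ _ := rfl
  comp_inv_hom _ _ := rfl
  comp_naturality _ _ _ _ := rfl
  unit _ := ⟨⟩
  unitInv _ := ⟨⟩
  left_unit _ := Subsingleton.elim _ _
  right_unit _ := Subsingleton.elim _ _
  unit_hom_inv _ := rfl
  unit_inv_hom _ := rfl
  unit_naturality _ := rfl
  comp_assoc _ _ _ _ _ := rfl
  comp_left_unit _ _ := rfl
  comp_right_unit _ _ := rfl

/-- The functor with constant value `I`. -/
abbrev constF (B : Type u₁) [DoubleCategory.{z₁, w₁, v₁, u₁} B] (I : PDFunctor DPoint D) :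
    PDFunctor B D :=
  (toPoint B).compF I

/-- The functor `x ↦ T (P x, Q x)`, for a functor `T` of two variables. -/
abbrev ap {E : Type u₄} [DoubleCategory.{z₄, w₄, v₄, u₄} E] (T : PDFunctor (C × D) E)
    (P : PDFunctor B C) (Q : PDFunctor B D) : PDFunctor B E :=
  (pair P Q).compF T

/-- The value of a functor of two variables on objects, 1h-cells, 1v-cells and 2-cells. -/
abbrev o (T : PDFunctor (B × C) D) (X : B) (Y : C) : D := T.obj (X, Y)

abbrev h (T : PDFunctor (B × C) D) {X X' : B} {Y Y' : C} (f : HHom X X') (g : HHom Y Y') :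
    HHom (T.o X Y) (T.o X' Y') :=
  T.hmap (A := (X, Y)) (B := (X', Y')) (f, g)

abbrev v (T : PDFunctor (B × C) D) {X X' : B} {Y Y' : C} (p : X ⟶ X') (q : Y ⟶ Y') :
    T.o X Y ⟶ T.o X' Y' :=
  T.map (X := (X, Y)) (Y := (X', Y')) (p, q)

abbrev c (T : PDFunctor (B × C) D) {X₁ X₂ X₁' X₂' : B} {Y₁ Y₂ Y₁' Y₂' : C} {f : HHom X₁ X₂}
    {f' : HHom X₁' X₂'} {g : HHom Y₁ Y₂} {g' : HHom Y₁' Y₂'} (a : Cell f f') (b : Cell g g') :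
    Cell (T.h f g) (T.h f' g') :=
  T.cmap (A := (X₁, Y₁)) (B := (X₂, Y₂)) (A' := (X₁', Y₁')) (B' := (X₂', Y₂')) (f := (f, g))
    (g := (f', g')) (a, b)

end Constructions
end PDFunctor

/-- A vertical strict transformation between pseudodouble functors. The components at objects
are natural with respect to 1v-cells. -/
structure VTrans {C : Type u₁} [DoubleCategory.{z₁, w₁, v₁, u₁} C] {D : Type u₂}
    [DoubleCategory.{z₂, w₂, v₂, u₂} D] (F G : PDFunctor C D) where
  app : ∀ A : C, F.obj A ⟶ G.obj A
  cell : ∀ {A B : C} (f : HHom A B), Cell (F.hmap f) (G.hmap f)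
  left_cell : ∀ {A B : C} (f : HHom A B), left (cell f) = app A
  right_cell : ∀ {A B : C} (f : HHom A B), right (cell f) = app B
  app_naturality : ∀ {A A' : C} (p : A ⟶ A'), F.map p ≫ app A' = app A ≫ G.map p
  cell_naturality : ∀ {A B A' B' : C} {f : HHom A B} {g : HHom A' B'} (a : Cell f g),
    F.cmap a ≫ᵥ cell g = cell f ≫ᵥ G.cmap a
  cell_comp : ∀ {A B E : C} (f : HHom A B) (g : HHom B E) (e : right (cell f) = left (cell g)),
    hcompCell (cell f) (cell g) e ≫ᵥ G.comp f g = F.comp f g ≫ᵥ cell (hcomp f g)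
  cell_unit : ∀ A : C, hidCell (app A) ≫ᵥ G.unit A = F.unit A ≫ᵥ cell (hid A)

/-- An invertible vertical strict transformation, with its inverse. -/
structure VIso {C : Type u₁} [DoubleCategory.{z₁, w₁, v₁, u₁} C] {D : Type u₂}
    [DoubleCategory.{z₂, w₂, v₂, u₂} D] (F G : PDFunctor C D) where
  hom : VTrans F G
  inv : VTrans G F
  app_hom_inv : ∀ A : C, hom.app A ≫ inv.app A = 𝟙 _
  app_inv_hom : ∀ A : C, inv.app A ≫ hom.app A = 𝟙 _
  cell_hom_inv : ∀ {A B : C} (f : HHom A B), hom.cell f ≫ᵥ inv.cell f = vid _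
  cell_inv_hom : ∀ {A B : C} (f : HHom A B), inv.cell f ≫ᵥ hom.cell f = vid _

open PDFunctor

/- The axioms below assert that certain identity vertical modifications exist, that is, that two
composite vertical strict transformations have the same components, both at objects (the laws with
index `₀`, equations of 1v-cells) and at 1h-cells (the laws with index `₁`, equations of
2-cells). -/

/-- The data of a vertically monoidal double category: tensor product, unit, and the invertible
vertical strict transformations `α : (A B) C ⟶ A (B C)`, `lam : I A ⟶ A`, `rho : A I ⟶ A`. -/
structure VMonoidalData (D : Type u) [DoubleCategory.{z, w, v, u} D] where
  T : PDFunctor (D × D) D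
  I : PDFunctor DPoint D
  α : VIso
    (ap T (ap T (fstF D (D × D)) ((sndF D (D × D)).compF (fstF D D)))
      ((sndF D (D × D)).compF (sndF D D)))
    (ap T (fstF D (D × D))
      (ap T ((sndF D (D × D)).compF (fstF D D)) ((sndF D (D × D)).compF (sndF D D))))
  lam : VIso (ap T (constF D I) (idF D)) (idF D)
  rho : VIso (ap T (idF D) (constF D I)) (idF D)

namespace VMonoidalData

variable {D : Type u} [DoubleCategory.{z, w, v, u} D] (𝓓 : VMonoidalData D)

/-- The unit object and the unit 1h-cell (the values of the unit functor). -/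
abbrev I₀ : D := 𝓓.I.obj ⟨⟨⟩⟩

abbrev I₁ : HHom 𝓓.I₀ 𝓓.I₀ := 𝓓.I.hmap (A := ⟨⟨⟩⟩) (B := ⟨⟨⟩⟩) ⟨⟩

/-- Components of the associator, its inverse, and the unitors at objects and at 1h-cells. -/
abbrev α₀ (A B C : D) : 𝓓.T.o (𝓓.T.o A B) C ⟶ 𝓓.T.o A (𝓓.T.o B C) := 𝓓.α.hom.app (A, (B, C))

abbrev αi₀ (A B C : D) : 𝓓.T.o A (𝓓.T.o B C) ⟶ 𝓓.T.o (𝓓.T.o A B) C := 𝓓.α.inv.app (A, (B, C))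

abbrev α₁ {A A' B B' C C' : D} (f : HHom A A') (g : HHom B B') (h : HHom C C') :
    Cell (𝓓.T.h (𝓓.T.h f g) h) (𝓓.T.h f (𝓓.T.h g h)) :=
  𝓓.α.hom.cell (A := (A, (B, C))) (B := (A', (B', C'))) (f, (g, h))

abbrev αi₁ {A A' B B' C C' : D} (f : HHom A A') (g : HHom B B') (h : HHom C C') :
    Cell (𝓓.T.h f (𝓓.T.h g h)) (𝓓.T.h (𝓓.T.h f g) h) :=
  𝓓.α.inv.cell (A := (A, (B, C))) (B := (A', (B', C'))) (f, (g, h))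

abbrev lam₀ (A : D) : 𝓓.T.o 𝓓.I₀ A ⟶ A := 𝓓.lam.hom.app A

abbrev lam₁ {A A' : D} (f : HHom A A') : Cell (𝓓.T.h 𝓓.I₁ f) f := 𝓓.lam.hom.cell f

abbrev rho₀ (A : D) : 𝓓.T.o A 𝓓.I₀ ⟶ A := 𝓓.rho.hom.app A

abbrev rho₁ {A A' : D} (f : HHom A A') : Cell (𝓓.T.h f 𝓓.I₁) f := 𝓓.rho.hom.cell f

end VMonoidalData

/-- A vertically monoidal double category: the pentagon axiom and the three triangle axioms. -/
structure VMonoidal (D : Type u) [DoubleCategory.{z, w, v, u} D] extends VMonoidalData D where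
  pentagon₀ : ∀ A B C E : D,
    T.v (toVMonoidalData.α₀ A B C) (𝟙 E) ≫ toVMonoidalData.α₀ A (T.o B C) E ≫
        T.v (𝟙 A) (toVMonoidalData.α₀ B C E) =
      toVMonoidalData.α₀ (T.o A B) C E ≫ toVMonoidalData.α₀ A B (T.o C E)
  pentagon₁ : ∀ {A A' B B' C C' E E' : D} (f : HHom A A') (g : HHom B B') (h : HHom C C')
    (k : HHom E E'),
    T.c (toVMonoidalData.α₁ f g h) (vid k) ≫ᵥ toVMonoidalData.α₁ f (T.h g h) k ≫ᵥ
        T.c (vid f) (toVMonoidalData.α₁ g h k) =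
      toVMonoidalData.α₁ (T.h f g) h k ≫ᵥ toVMonoidalData.α₁ f g (T.h h k)
  triangle₀ : ∀ A B : D,
    toVMonoidalData.α₀ A toVMonoidalData.I₀ B ≫ T.v (𝟙 A) (toVMonoidalData.lam₀ B) =
      T.v (toVMonoidalData.rho₀ A) (𝟙 B)
  triangle₁ : ∀ {A A' B B' : D} (f : HHom A A') (g : HHom B B'),
    toVMonoidalData.α₁ f toVMonoidalData.I₁ g ≫ᵥ T.c (vid f) (toVMonoidalData.lam₁ g) =
      T.c (toVMonoidalData.rho₁ f) (vid g)
  triangleLeft₀ : ∀ A B : D,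
    toVMonoidalData.α₀ toVMonoidalData.I₀ A B ≫ toVMonoidalData.lam₀ (T.o A B) =
      T.v (toVMonoidalData.lam₀ A) (𝟙 B)
  triangleLeft₁ : ∀ {A A' B B' : D} (f : HHom A A') (g : HHom B B'),
    toVMonoidalData.α₁ toVMonoidalData.I₁ f g ≫ᵥ toVMonoidalData.lam₁ (T.h f g) =
      T.c (toVMonoidalData.lam₁ f) (vid g)
  triangleRight₀ : ∀ A B : D,
    toVMonoidalData.α₀ A B toVMonoidalData.I₀ ≫ T.v (𝟙 A) (toVMonoidalData.rho₀ B) =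
      toVMonoidalData.rho₀ (T.o A B)
  triangleRight₁ : ∀ {A A' B B' : D} (f : HHom A A') (g : HHom B B'),
    toVMonoidalData.α₁ f g toVMonoidalData.I₁ ≫ᵥ T.c (vid f) (toVMonoidalData.rho₁ g) =
      toVMonoidalData.rho₁ (T.h f g)

/-- A (vertical double) braiding `Φ : A B ⟶ B A` on a vertically monoidal double category, with
the two hexagon axioms. -/
structure VBraiding {M : Type u} [DoubleCategory.{z, w, v, u} M] (𝓜 : VMonoidal M) where
  Φ : VIso 𝓜.T (ap 𝓜.T (sndF M M) (fstF M M))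
  hexagon₀ : ∀ A B C : M,
    𝓜.T.v (Φ.hom.app (A, B)) (𝟙 C) ≫ 𝓜.α₀ B A C ≫ 𝓜.T.v (𝟙 B) (Φ.hom.app (A, C)) =
      𝓜.α₀ A B C ≫ Φ.hom.app (A, 𝓜.T.o B C) ≫ 𝓜.α₀ B C A
  hexagon₁ : ∀ {A A' B B' C C' : M} (f : HHom A A') (g : HHom B B') (h : HHom C C'),
    𝓜.T.c (Φ.hom.cell (A := (A, B)) (B := (A', B')) (f, g)) (vid h) ≫ᵥ 𝓜.α₁ g f h ≫ᵥ
        𝓜.T.c (vid g) (Φ.hom.cell (A := (A, C)) (B := (A', C')) (f, h)) =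
      𝓜.α₁ f g h ≫ᵥ
        Φ.hom.cell (A := (A, 𝓜.T.o B C)) (B := (A', 𝓜.T.o B' C')) (f, 𝓜.T.h g h) ≫ᵥ 𝓜.α₁ g h f
  hexagonInv₀ : ∀ A B C : M,
    𝓜.T.v (𝟙 A) (Φ.hom.app (B, C)) ≫ 𝓜.αi₀ A C B ≫ 𝓜.T.v (Φ.hom.app (A, C)) (𝟙 B) =
      𝓜.αi₀ A B C ≫ Φ.hom.app (𝓜.T.o A B, C) ≫ 𝓜.αi₀ C A B
  hexagonInv₁ : ∀ {A A' B B' C C' : M} (f : HHom A A') (g : HHom B B') (h : HHom C C'),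
    𝓜.T.c (vid f) (Φ.hom.cell (A := (B, C)) (B := (B', C')) (g, h)) ≫ᵥ 𝓜.αi₁ f h g ≫ᵥ
        𝓜.T.c (Φ.hom.cell (A := (A, C)) (B := (A', C')) (f, h)) (vid g) =
      𝓜.αi₁ f g h ≫ᵥ
        Φ.hom.cell (A := (𝓜.T.o A B, C)) (B := (𝓜.T.o A' B', C')) (𝓜.T.h f g, h) ≫ᵥ 𝓜.αi₁ h f g

namespace VBraiding

variable {M : Type u} [DoubleCategory.{z, w, v, u} M] {𝓜 : VMonoidal M} (Ψ : VBraiding 𝓜)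

/-- Components of the braiding at objects and at 1h-cells. -/
abbrev Φ₀ (A B : M) : 𝓜.T.o A B ⟶ 𝓜.T.o B A := Ψ.Φ.hom.app (A, B)

abbrev Φ₁ {A A' B B' : M} (f : HHom A A') (g : HHom B B') : Cell (𝓜.T.h f g) (𝓜.T.h g f) :=
  Ψ.Φ.hom.cell (A := (A, B)) (B := (A', B')) (f, g)

/-- The interchanger `(A B) (C E) ⟶ (A C) (B E)` of the tensor product, given by
`A ⊗ Φ_{B,C} ⊗ E` up to associativity, at objects and at 1h-cells. -/
def mid₀ (A B C E : M) : 𝓜.T.o (𝓜.T.o A B) (𝓜.T.o C E) ⟶ 𝓜.T.o (𝓜.T.o A C) (𝓜.T.o B E) :=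
  𝓜.α₀ A B (𝓜.T.o C E) ≫
    𝓜.T.v (𝟙 A) (𝓜.αi₀ B C E ≫ 𝓜.T.v (Ψ.Φ₀ B C) (𝟙 E) ≫ 𝓜.α₀ C B E) ≫ 𝓜.αi₀ A C (𝓜.T.o B E)

def mid₁ {A A' B B' C C' E E' : M} (f : HHom A A') (g : HHom B B') (h : HHom C C')
    (k : HHom E E') :
    Cell (𝓜.T.h (𝓜.T.h f g) (𝓜.T.h h k)) (𝓜.T.h (𝓜.T.h f h) (𝓜.T.h g k)) :=
  𝓜.α₁ f g (𝓜.T.h h k) ≫ᵥ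
    𝓜.T.c (vid f) (𝓜.αi₁ g h k ≫ᵥ 𝓜.T.c (Ψ.Φ₁ g h) (vid k) ≫ᵥ 𝓜.α₁ h g k) ≫ᵥ
      𝓜.αi₁ f h (𝓜.T.h g k)

end VBraiding

/-- The data of a vertical lax action of `M` on `D`: a pseudodouble functor `F : M × D ⟶ D`
(written `M A` for `F (M, A)`) and vertical strict transformations, not necessarily invertible,
`β : M (N A) ⟶ (M N) A` and `ν : A ⟶ J A`, where `J` is the unit of `M`. -/
structure LaxActionData {M : Type u₁} [DoubleCategory.{z₁, w₁, v₁, u₁} M] (𝓜 : VMonoidal M)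
    (D : Type u₂) [DoubleCategory.{z₂, w₂, v₂, u₂} D] where
  F : PDFunctor (M × D) D
  β : VTrans
    (ap F (fstF M (M × D))
      (ap F ((sndF M (M × D)).compF (fstF M D)) ((sndF M (M × D)).compF (sndF M D))))
    (ap F (ap 𝓜.T (fstF M (M × D)) ((sndF M (M × D)).compF (fstF M D)))
      ((sndF M (M × D)).compF (sndF M D)))
  ν : VTrans (idF D) (ap F (constF D 𝓜.I) (idF D))

namespace LaxActionData

variable {M : Type u₁} [DoubleCategory.{z₁, w₁, v₁, u₁} M] {𝓜 : VMonoidal M}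
  {D : Type u₂} [DoubleCategory.{z₂, w₂, v₂, u₂} D] (𝓐 : LaxActionData 𝓜 D)

/-- Components of `β` and `ν` at objects and at 1h-cells. -/
abbrev β₀ (P Q : M) (A : D) : 𝓐.F.o P (𝓐.F.o Q A) ⟶ 𝓐.F.o (𝓜.T.o P Q) A := 𝓐.β.app (P, (Q, A))

abbrev β₁ {P P' Q Q' : M} {A A' : D} (p : HHom P P') (q : HHom Q Q') (f : HHom A A') :
    Cell (𝓐.F.h p (𝓐.F.h q f)) (𝓐.F.h (𝓜.T.h p q) f) :=
  𝓐.β.cell (A := (P, (Q, A))) (B := (P', (Q', A'))) (p, (q, f))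

abbrev ν₀ (A : D) : A ⟶ 𝓐.F.o 𝓜.I₀ A := 𝓐.ν.app A

abbrev ν₁ {A A' : D} (f : HHom A A') : Cell f (𝓐.F.h 𝓜.I₁ f) := 𝓐.ν.cell f

end LaxActionData

/-- A vertical lax action `(F, β, ν)`: the pentagon axiom for `β` and the two unit axioms. -/
structure LaxAction {M : Type u₁} [DoubleCategory.{z₁, w₁, v₁, u₁} M] (𝓜 : VMonoidal M)
    (D : Type u₂) [DoubleCategory.{z₂, w₂, v₂, u₂} D] extends LaxActionData 𝓜 D where
  pentagon₀ : ∀ (P Q R : M) (A : D),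
    F.v (𝟙 P) (toLaxActionData.β₀ Q R A) ≫ toLaxActionData.β₀ P (𝓜.T.o Q R) A =
      toLaxActionData.β₀ P Q (F.o R A) ≫ toLaxActionData.β₀ (𝓜.T.o P Q) R A ≫
        F.v (𝓜.α₀ P Q R) (𝟙 A)
  pentagon₁ : ∀ {P P' Q Q' R R' : M} {A A' : D} (p : HHom P P') (q : HHom Q Q') (r : HHom R R')
    (f : HHom A A'),
    F.c (vid p) (toLaxActionData.β₁ q r f) ≫ᵥ toLaxActionData.β₁ p (𝓜.T.h q r) f =
      toLaxActionData.β₁ p q (F.h r f) ≫ᵥ toLaxActionData.β₁ (𝓜.T.h p q) r f ≫ᵥ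
        F.c (𝓜.α₁ p q r) (vid f)
  unitLeft₀ : ∀ (P : M) (A : D),
    toLaxActionData.ν₀ (F.o P A) ≫ toLaxActionData.β₀ 𝓜.I₀ P A ≫ F.v (𝓜.lam₀ P) (𝟙 A) =
      𝟙 (F.o P A)
  unitLeft₁ : ∀ {P P' : M} {A A' : D} (p : HHom P P') (f : HHom A A'),
    toLaxActionData.ν₁ (F.h p f) ≫ᵥ toLaxActionData.β₁ 𝓜.I₁ p f ≫ᵥ F.c (𝓜.lam₁ p) (vid f) =
      vid (F.h p f)
  unitRight₀ : ∀ (P : M) (A : D),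
    F.v (𝟙 P) (toLaxActionData.ν₀ A) ≫ toLaxActionData.β₀ P 𝓜.I₀ A ≫ F.v (𝓜.rho₀ P) (𝟙 A) =
      𝟙 (F.o P A)
  unitRight₁ : ∀ {P P' : M} {A A' : D} (p : HHom P P') (f : HHom A A'),
    F.c (vid p) (toLaxActionData.ν₁ f) ≫ᵥ toLaxActionData.β₁ p 𝓜.I₁ f ≫ᵥ
      F.c (𝓜.rho₁ p) (vid f) = vid (F.h p f)

section Structures

variable {M : Type u₁} [DoubleCategory.{z₁, w₁, v₁, u₁} M] {D : Type u₂}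
  [DoubleCategory.{z₂, w₂, v₂, u₂} D] {𝓜 : VMonoidal M}

/-- The data `F² : (P A) (Q B) ⟶ (P Q) (A B)` and `F⁰ : I ⟶ J I` of a lax monoidal structure on
`F : M × D ⟶ D`, where `M × D` has the componentwise monoidal structure. -/
structure LaxMonoidalData (𝓐 : LaxAction 𝓜 D) (𝓓 : VMonoidal D) where
  F2 : VTrans
    (ap 𝓓.T ((fstF (M × D) (M × D)).compF 𝓐.F) ((sndF (M × D) (M × D)).compF 𝓐.F))
    (ap 𝓐.F
      (ap 𝓜.T ((fstF (M × D) (M × D)).compF (fstF M D)) ((sndF (M × D) (M × D)).compF (fstF M D)))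
      (ap 𝓓.T ((fstF (M × D) (M × D)).compF (sndF M D))
        ((sndF (M × D) (M × D)).compF (sndF M D))))
  F0 : VTrans 𝓓.I (ap 𝓐.F 𝓜.I 𝓓.I)

namespace LaxMonoidalData

variable {𝓐 : LaxAction 𝓜 D} {𝓓 : VMonoidal D} (L : LaxMonoidalData 𝓐 𝓓)

/-- Components of `F²` and `F⁰` at objects and at 1h-cells. -/
abbrev m₀ (P : M) (A : D) (Q : M) (B : D) :
    𝓓.T.o (𝓐.F.o P A) (𝓐.F.o Q B) ⟶ 𝓐.F.o (𝓜.T.o P Q) (𝓓.T.o A B) :=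
  L.F2.app ((P, A), (Q, B))

abbrev m₁ {P P' Q Q' : M} {A A' B B' : D} (p : HHom P P') (f : HHom A A') (q : HHom Q Q')
    (g : HHom B B') :
    Cell (𝓓.T.h (𝓐.F.h p f) (𝓐.F.h q g)) (𝓐.F.h (𝓜.T.h p q) (𝓓.T.h f g)) :=
  L.F2.cell (A := ((P, A), (Q, B))) (B := ((P', A'), (Q', B'))) ((p, f), (q, g))

abbrev ι₀ : 𝓓.I₀ ⟶ 𝓐.F.o 𝓜.I₀ 𝓓.I₀ := L.F0.app ⟨⟨⟩⟩

abbrev ι₁ : Cell 𝓓.I₁ (𝓐.F.h 𝓜.I₁ 𝓓.I₁) := L.F0.cell (A := ⟨⟨⟩⟩) (B := ⟨⟨⟩⟩) ⟨⟩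

end LaxMonoidalData

/-- A lax monoidal structure `(F², F⁰)` on the pseudodouble functor `F` of an action:
associativity and the two unit laws. -/
structure LaxMonoidal (𝓐 : LaxAction 𝓜 D) (𝓓 : VMonoidal D) extends LaxMonoidalData 𝓐 𝓓 where
  assoc₀ : ∀ (P : M) (A : D) (Q : M) (B : D) (R : M) (C : D),
    𝓓.T.v (toLaxMonoidalData.m₀ P A Q B) (𝟙 (𝓐.F.o R C)) ≫
        toLaxMonoidalData.m₀ (𝓜.T.o P Q) (𝓓.T.o A B) R C ≫ 𝓐.F.v (𝓜.α₀ P Q R) (𝓓.α₀ A B C) =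
      𝓓.α₀ (𝓐.F.o P A) (𝓐.F.o Q B) (𝓐.F.o R C) ≫
        𝓓.T.v (𝟙 (𝓐.F.o P A)) (toLaxMonoidalData.m₀ Q B R C) ≫
          toLaxMonoidalData.m₀ P A (𝓜.T.o Q R) (𝓓.T.o B C)
  assoc₁ : ∀ {P P' Q Q' R R' : M} {A A' B B' C C' : D} (p : HHom P P') (f : HHom A A')
    (q : HHom Q Q') (g : HHom B B') (r : HHom R R') (h : HHom C C'),
    𝓓.T.c (toLaxMonoidalData.m₁ p f q g) (vid (𝓐.F.h r h)) ≫ᵥ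
        toLaxMonoidalData.m₁ (𝓜.T.h p q) (𝓓.T.h f g) r h ≫ᵥ 𝓐.F.c (𝓜.α₁ p q r) (𝓓.α₁ f g h) =
      𝓓.α₁ (𝓐.F.h p f) (𝓐.F.h q g) (𝓐.F.h r h) ≫ᵥ
        𝓓.T.c (vid (𝓐.F.h p f)) (toLaxMonoidalData.m₁ q g r h) ≫ᵥ
          toLaxMonoidalData.m₁ p f (𝓜.T.h q r) (𝓓.T.h g h)
  unitRight₀ : ∀ (P : M) (A : D),
    𝓓.T.v (𝟙 (𝓐.F.o P A)) toLaxMonoidalData.ι₀ ≫ toLaxMonoidalData.m₀ P A 𝓜.I₀ 𝓓.I₀ ≫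
      𝓐.F.v (𝓜.rho₀ P) (𝓓.rho₀ A) = 𝓓.rho₀ (𝓐.F.o P A)
  unitRight₁ : ∀ {P P' : M} {A A' : D} (p : HHom P P') (f : HHom A A'),
    𝓓.T.c (vid (𝓐.F.h p f)) toLaxMonoidalData.ι₁ ≫ᵥ toLaxMonoidalData.m₁ p f 𝓜.I₁ 𝓓.I₁ ≫ᵥ
      𝓐.F.c (𝓜.rho₁ p) (𝓓.rho₁ f) = 𝓓.rho₁ (𝓐.F.h p f)
  unitLeft₀ : ∀ (P : M) (A : D),
    𝓓.T.v toLaxMonoidalData.ι₀ (𝟙 (𝓐.F.o P A)) ≫ toLaxMonoidalData.m₀ 𝓜.I₀ 𝓓.I₀ P A ≫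
      𝓐.F.v (𝓜.lam₀ P) (𝓓.lam₀ A) = 𝓓.lam₀ (𝓐.F.o P A)
  unitLeft₁ : ∀ {P P' : M} {A A' : D} (p : HHom P P') (f : HHom A A'),
    𝓓.T.c toLaxMonoidalData.ι₁ (vid (𝓐.F.h p f)) ≫ᵥ toLaxMonoidalData.m₁ 𝓜.I₁ 𝓓.I₁ p f ≫ᵥ
      𝓐.F.c (𝓜.lam₁ p) (𝓓.lam₁ f) = 𝓓.lam₁ (𝓐.F.h p f)

/-- The lax action is lax monoidal with trivial cocycle modifications: `β` and `ν` are monoidal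
vertical transformations whose structure modifications `β²`, `β⁰`, `ν²`, `ν⁰` are identities. Here
the functors `P (Q A)` and `(P Q) A` carry the lax monoidal structures induced by `F²`, `F⁰` and,
for the second, by the interchanger of the braided monoidal double category `M`. -/
structure LaxMonoidal.HasTrivialCocycles {𝓐 : LaxAction 𝓜 D} {𝓓 : VMonoidal D}
    (L : LaxMonoidal 𝓐 𝓓) (Ψ : VBraiding 𝓜) : Prop where
  β2₀ : ∀ (P Q : M) (A : D) (R S : M) (B : D),
    𝓓.T.v (𝓐.β₀ P Q A) (𝓐.β₀ R S B) ≫ L.m₀ (𝓜.T.o P Q) A (𝓜.T.o R S) B ≫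
        𝓐.F.v (Ψ.mid₀ P Q R S) (𝟙 (𝓓.T.o A B)) =
      L.m₀ P (𝓐.F.o Q A) R (𝓐.F.o S B) ≫ 𝓐.F.v (𝟙 (𝓜.T.o P R)) (L.m₀ Q A S B) ≫
        𝓐.β₀ (𝓜.T.o P R) (𝓜.T.o Q S) (𝓓.T.o A B)
  β2₁ : ∀ {P P' Q Q' R R' S S' : M} {A A' B B' : D} (p : HHom P P') (q : HHom Q Q')
    (f : HHom A A') (r : HHom R R') (s : HHom S S') (g : HHom B B'),
    𝓓.T.c (𝓐.β₁ p q f) (𝓐.β₁ r s g) ≫ᵥ L.m₁ (𝓜.T.h p q) f (𝓜.T.h r s) g ≫ᵥ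
        𝓐.F.c (Ψ.mid₁ p q r s) (vid (𝓓.T.h f g)) =
      L.m₁ p (𝓐.F.h q f) r (𝓐.F.h s g) ≫ᵥ 𝓐.F.c (vid (𝓜.T.h p r)) (L.m₁ q f s g) ≫ᵥ
        𝓐.β₁ (𝓜.T.h p r) (𝓜.T.h q s) (𝓓.T.h f g)
  β0₀ : L.ι₀ = L.ι₀ ≫ 𝓐.F.v (𝟙 𝓜.I₀) L.ι₀ ≫ 𝓐.β₀ 𝓜.I₀ 𝓜.I₀ 𝓓.I₀ ≫
    𝓐.F.v (𝓜.lam₀ 𝓜.I₀) (𝟙 𝓓.I₀)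
  β0₁ : L.ι₁ = L.ι₁ ≫ᵥ 𝓐.F.c (vid 𝓜.I₁) L.ι₁ ≫ᵥ 𝓐.β₁ 𝓜.I₁ 𝓜.I₁ 𝓓.I₁ ≫ᵥ
    𝓐.F.c (𝓜.lam₁ 𝓜.I₁) (vid 𝓓.I₁)
  ν2₀ : ∀ A B : D, 𝓐.ν₀ (𝓓.T.o A B) =
    𝓓.T.v (𝓐.ν₀ A) (𝓐.ν₀ B) ≫ L.m₀ 𝓜.I₀ A 𝓜.I₀ B ≫ 𝓐.F.v (𝓜.lam₀ 𝓜.I₀) (𝟙 (𝓓.T.o A B))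
  ν2₁ : ∀ {A A' B B' : D} (f : HHom A A') (g : HHom B B'), 𝓐.ν₁ (𝓓.T.h f g) =
    𝓓.T.c (𝓐.ν₁ f) (𝓐.ν₁ g) ≫ᵥ L.m₁ 𝓜.I₁ f 𝓜.I₁ g ≫ᵥ
      𝓐.F.c (𝓜.lam₁ 𝓜.I₁) (vid (𝓓.T.h f g))
  ν0₀ : L.ι₀ = 𝓐.ν₀ 𝓓.I₀
  ν0₁ : L.ι₁ = 𝓐.ν₁ 𝓓.I₁

/-- The vertical strict transformation `t : A (P B) ⟶ P (A B)` underlying a left strength. -/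
structure LeftStrengthData (𝓐 : LaxAction 𝓜 D) (𝓓 : VMonoidal D) where
  t : VTrans
    (ap 𝓓.T ((sndF M (D × D)).compF (fstF D D))
      (ap 𝓐.F (fstF M (D × D)) ((sndF M (D × D)).compF (sndF D D))))
    (ap 𝓐.F (fstF M (D × D))
      (ap 𝓓.T ((sndF M (D × D)).compF (fstF D D)) ((sndF M (D × D)).compF (sndF D D))))

/-- The vertical strict transformation `s : (P A) B ⟶ P (A B)` underlying a right strength. -/
structure RightStrengthData (𝓐 : LaxAction 𝓜 D) (𝓓 : VMonoidal D) where
  s : VTrans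
    (ap 𝓓.T (ap 𝓐.F (fstF M (D × D)) ((sndF M (D × D)).compF (fstF D D)))
      ((sndF M (D × D)).compF (sndF D D)))
    (ap 𝓐.F (fstF M (D × D))
      (ap 𝓓.T ((sndF M (D × D)).compF (fstF D D)) ((sndF M (D × D)).compF (sndF D D))))

section Components

variable {𝓐 : LaxAction 𝓜 D} {𝓓 : VMonoidal D}

/-- Components of a left strength at objects and at 1h-cells. -/
abbrev LeftStrengthData.t₀ (S : LeftStrengthData 𝓐 𝓓) (P : M) (A B : D) :
    𝓓.T.o A (𝓐.F.o P B) ⟶ 𝓐.F.o P (𝓓.T.o A B) :=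
  S.t.app (P, (A, B))

abbrev LeftStrengthData.t₁ (S : LeftStrengthData 𝓐 𝓓) {P P' : M} {A A' B B' : D}
    (p : HHom P P') (f : HHom A A') (g : HHom B B') :
    Cell (𝓓.T.h f (𝓐.F.h p g)) (𝓐.F.h p (𝓓.T.h f g)) :=
  S.t.cell (A := (P, (A, B))) (B := (P', (A', B'))) (p, (f, g))

/-- Components of a right strength at objects and at 1h-cells. -/
abbrev RightStrengthData.s₀ (S : RightStrengthData 𝓐 𝓓) (P : M) (A B : D) :
    𝓓.T.o (𝓐.F.o P A) B ⟶ 𝓐.F.o P (𝓓.T.o A B) :=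
  S.s.app (P, (A, B))

abbrev RightStrengthData.s₁ (S : RightStrengthData 𝓐 𝓓) {P P' : M} {A A' B B' : D}
    (p : HHom P P') (f : HHom A A') (g : HHom B B') :
    Cell (𝓓.T.h (𝓐.F.h p f) g) (𝓐.F.h p (𝓓.T.h f g)) :=
  S.s.cell (A := (P, (A, B))) (B := (P', (A', B'))) (p, (f, g))

end Components

/-- A left (vertical) strength of a lax action: compatibility with the unit (`x`) and the
associativity (`y`) of `D`, and with `β` (`w`) and `ν` (`z`). As the action is only lax, the
strength is not required to be invertible. -/
structure LeftStrength (𝓐 : LaxAction 𝓜 D) (𝓓 : VMonoidal D) extends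
    LeftStrengthData 𝓐 𝓓 where
  x₀ : ∀ (P : M) (A : D), 𝓓.lam₀ (𝓐.F.o P A) =
    toLeftStrengthData.t₀ P 𝓓.I₀ A ≫ 𝓐.F.v (𝟙 P) (𝓓.lam₀ A)
  x₁ : ∀ {P P' : M} {A A' : D} (p : HHom P P') (f : HHom A A'), 𝓓.lam₁ (𝓐.F.h p f) =
    toLeftStrengthData.t₁ p 𝓓.I₁ f ≫ᵥ 𝓐.F.c (vid p) (𝓓.lam₁ f)
  y₀ : ∀ (P : M) (A B C : D),
    toLeftStrengthData.t₀ P (𝓓.T.o A B) C ≫ 𝓐.F.v (𝟙 P) (𝓓.α₀ A B C) =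
      𝓓.α₀ A B (𝓐.F.o P C) ≫ 𝓓.T.v (𝟙 A) (toLeftStrengthData.t₀ P B C) ≫
        toLeftStrengthData.t₀ P A (𝓓.T.o B C)
  y₁ : ∀ {P P' : M} {A A' B B' C C' : D} (p : HHom P P') (f : HHom A A') (g : HHom B B')
    (h : HHom C C'),
    toLeftStrengthData.t₁ p (𝓓.T.h f g) h ≫ᵥ 𝓐.F.c (vid p) (𝓓.α₁ f g h) =
      𝓓.α₁ f g (𝓐.F.h p h) ≫ᵥ 𝓓.T.c (vid f) (toLeftStrengthData.t₁ p g h) ≫ᵥ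
        toLeftStrengthData.t₁ p f (𝓓.T.h g h)
  w₀ : ∀ (P Q : M) (A B : D),
    𝓓.T.v (𝟙 A) (𝓐.β₀ P Q B) ≫ toLeftStrengthData.t₀ (𝓜.T.o P Q) A B =
      toLeftStrengthData.t₀ P A (𝓐.F.o Q B) ≫ 𝓐.F.v (𝟙 P) (toLeftStrengthData.t₀ Q A B) ≫
        𝓐.β₀ P Q (𝓓.T.o A B)
  w₁ : ∀ {P P' Q Q' : M} {A A' B B' : D} (p : HHom P P') (q : HHom Q Q') (f : HHom A A')
    (g : HHom B B'),
    𝓓.T.c (vid f) (𝓐.β₁ p q g) ≫ᵥ toLeftStrengthData.t₁ (𝓜.T.h p q) f g =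
      toLeftStrengthData.t₁ p f (𝓐.F.h q g) ≫ᵥ 𝓐.F.c (vid p) (toLeftStrengthData.t₁ q f g) ≫ᵥ
        𝓐.β₁ p q (𝓓.T.h f g)
  z₀ : ∀ A B : D, 𝓐.ν₀ (𝓓.T.o A B) =
    𝓓.T.v (𝟙 A) (𝓐.ν₀ B) ≫ toLeftStrengthData.t₀ 𝓜.I₀ A B
  z₁ : ∀ {A A' B B' : D} (f : HHom A A') (g : HHom B B'), 𝓐.ν₁ (𝓓.T.h f g) =
    𝓓.T.c (vid f) (𝓐.ν₁ g) ≫ᵥ toLeftStrengthData.t₁ 𝓜.I₁ f g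

/-- A right (vertical) strength of a lax action. -/
structure RightStrength (𝓐 : LaxAction 𝓜 D) (𝓓 : VMonoidal D) extends
    RightStrengthData 𝓐 𝓓 where
  x₀ : ∀ (P : M) (A : D), 𝓓.rho₀ (𝓐.F.o P A) =
    toRightStrengthData.s₀ P A 𝓓.I₀ ≫ 𝓐.F.v (𝟙 P) (𝓓.rho₀ A)
  x₁ : ∀ {P P' : M} {A A' : D} (p : HHom P P') (f : HHom A A'), 𝓓.rho₁ (𝓐.F.h p f) =
    toRightStrengthData.s₁ p f 𝓓.I₁ ≫ᵥ 𝓐.F.c (vid p) (𝓓.rho₁ f)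
  y₀ : ∀ (P : M) (A B C : D),
    𝓓.T.v (toRightStrengthData.s₀ P A B) (𝟙 C) ≫ toRightStrengthData.s₀ P (𝓓.T.o A B) C ≫
        𝓐.F.v (𝟙 P) (𝓓.α₀ A B C) =
      𝓓.α₀ (𝓐.F.o P A) B C ≫ toRightStrengthData.s₀ P A (𝓓.T.o B C)
  y₁ : ∀ {P P' : M} {A A' B B' C C' : D} (p : HHom P P') (f : HHom A A') (g : HHom B B')
    (h : HHom C C'),
    𝓓.T.c (toRightStrengthData.s₁ p f g) (vid h) ≫ᵥ toRightStrengthData.s₁ p (𝓓.T.h f g) h ≫ᵥ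
        𝓐.F.c (vid p) (𝓓.α₁ f g h) =
      𝓓.α₁ (𝓐.F.h p f) g h ≫ᵥ toRightStrengthData.s₁ p f (𝓓.T.h g h)
  w₀ : ∀ (P Q : M) (A B : D),
    𝓓.T.v (𝓐.β₀ P Q A) (𝟙 B) ≫ toRightStrengthData.s₀ (𝓜.T.o P Q) A B =
      toRightStrengthData.s₀ P (𝓐.F.o Q A) B ≫ 𝓐.F.v (𝟙 P) (toRightStrengthData.s₀ Q A B) ≫
        𝓐.β₀ P Q (𝓓.T.o A B)
  w₁ : ∀ {P P' Q Q' : M} {A A' B B' : D} (p : HHom P P') (q : HHom Q Q') (f : HHom A A')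
    (g : HHom B B'),
    𝓓.T.c (𝓐.β₁ p q f) (vid g) ≫ᵥ toRightStrengthData.s₁ (𝓜.T.h p q) f g =
      toRightStrengthData.s₁ p (𝓐.F.h q f) g ≫ᵥ 𝓐.F.c (vid p) (toRightStrengthData.s₁ q f g) ≫ᵥ
        𝓐.β₁ p q (𝓓.T.h f g)
  z₀ : ∀ A B : D, 𝓐.ν₀ (𝓓.T.o A B) =
    𝓓.T.v (𝓐.ν₀ A) (𝟙 B) ≫ toRightStrengthData.s₀ 𝓜.I₀ A B
  z₁ : ∀ {A A' B B' : D} (f : HHom A A') (g : HHom B B'), 𝓐.ν₁ (𝓓.T.h f g) =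
    𝓓.T.c (𝓐.ν₁ f) (vid g) ≫ᵥ toRightStrengthData.s₁ 𝓜.I₁ f g

/-- The left strength `t` and the right strength `s` make the action bistrong: the identity
modification `q` between the two ways `(A (P B)) C ⟶ P (A (B C))`. -/
structure IsBistrong {𝓐 : LaxAction 𝓜 D} {𝓓 : VMonoidal D} (t : LeftStrength 𝓐 𝓓)
    (s : RightStrength 𝓐 𝓓) : Prop where
  q₀ : ∀ (P : M) (A B C : D),
    𝓓.α₀ A (𝓐.F.o P B) C ≫ 𝓓.T.v (𝟙 A) (s.s₀ P B C) ≫ t.t₀ P A (𝓓.T.o B C) =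
      𝓓.T.v (t.t₀ P A B) (𝟙 C) ≫ s.s₀ P (𝓓.T.o A B) C ≫ 𝓐.F.v (𝟙 P) (𝓓.α₀ A B C)
  q₁ : ∀ {P P' : M} {A A' B B' C C' : D} (p : HHom P P') (f : HHom A A') (g : HHom B B')
    (h : HHom C C'),
    𝓓.α₁ f (𝓐.F.h p g) h ≫ᵥ 𝓓.T.c (vid f) (s.s₁ p g h) ≫ᵥ t.t₁ p f (𝓓.T.h g h) =
      𝓓.T.c (t.t₁ p f g) (vid h) ≫ᵥ s.s₁ p (𝓓.T.h f g) h ≫ᵥ 𝓐.F.c (vid p) (𝓓.α₁ f g h)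

/-- The bistrong action is commutative: the identity modification `c` between the two ways
`(P A) (Q B) ⟶ (Q P) (A B)`, where the one that applies the right strength first is followed by
the braiding `P Q ⟶ Q P`. -/
structure IsCommutative {𝓐 : LaxAction 𝓜 D} {𝓓 : VMonoidal D} (Ψ : VBraiding 𝓜)
    (t : LeftStrength 𝓐 𝓓) (s : RightStrength 𝓐 𝓓) : Prop where
  c₀ : ∀ (P : M) (A : D) (Q : M) (B : D),
    t.t₀ Q (𝓐.F.o P A) B ≫ 𝓐.F.v (𝟙 Q) (s.s₀ P A B) ≫ 𝓐.β₀ Q P (𝓓.T.o A B) =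
      s.s₀ P A (𝓐.F.o Q B) ≫ 𝓐.F.v (𝟙 P) (t.t₀ Q A B) ≫ 𝓐.β₀ P Q (𝓓.T.o A B) ≫
        𝓐.F.v (Ψ.Φ₀ P Q) (𝟙 (𝓓.T.o A B))
  c₁ : ∀ {P P' Q Q' : M} {A A' B B' : D} (p : HHom P P') (f : HHom A A') (q : HHom Q Q')
    (g : HHom B B'),
    t.t₁ q (𝓐.F.h p f) g ≫ᵥ 𝓐.F.c (vid q) (s.s₁ p f g) ≫ᵥ 𝓐.β₁ q p (𝓓.T.h f g) =
      s.s₁ p f (𝓐.F.h q g) ≫ᵥ 𝓐.F.c (vid p) (t.t₁ q f g) ≫ᵥ 𝓐.β₁ p q (𝓓.T.h f g) ≫ᵥ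
        𝓐.F.c (Ψ.Φ₁ p q) (vid (𝓓.T.h f g))

end Structures

/-! A strength is a multiplication in which one of the two actors is the unit $J$. From $F^2$ one
obtains $t^M_{A,B}=\nu_A(MB);F^2_{J,A,M,B};\lambda_M(AB)$ and
$s^M_{A,B}=(MA)\nu_B;F^2_{M,A,J,B};\rho_M(AB)$. From $s$ and $t$ one obtains
$F^2_{M,A,N,B}=s^M_{A,NB};Mt^N_{A,B};\beta_{M,N,AB}$. The unit $\iota$ carries no information,
because $\nu^0$ forces $\iota=\nu_I$.

From multiplication to strengths, each law is the instance of a monoidal law with some actors equal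
to $J$. Associativity at $(J,J,P)$, $(P,J,J)$ and $(J,P,J)$ gives the associativity of $t$, that of
$s$, and the bistrength (`left_assoc`, `right_assoc`, `bistrong`). The $\beta^2$ law, put in a
flexible form in `nested`, gives compatibility of $t$ and $s$ with $\beta$. It also shows that
$s;Mt;\beta$ is $F^2$ (`right_left`), while $t;Ns;\beta$ is $F^2$ followed by the braiding
(`left_right`); comparing the two is commutativity.

From strengths to multiplication, associativity (`mulOf_assoc`) combines the bistrength, the
associativity of both strengths, their compatibility with $\beta$ and the pentagon of the action.
The $\beta^2$ law (`mulOf_β2`) is where commutativity enters: it exchanges the two inner actors.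

These arguments are equational and belong to ordinary category theory. A vertically monoidal double
category contains two monoidal categories: objects with 1v-cells, and 1h-cells with 2-cells under
vertical composition. The braiding and the action restrict to both, and an equation of vertical
transformations is a pair of equations, one in each. The computation is therefore done once, for
`CatLaxAction`, and used twice. Neither category sees horizontal composition and horizontal units.
Compatibility with those is obtained by building the new transformations as whiskerings and vertical
composites of the given ones, with components that unfold to the one-dimensional formulas. -/

/-! ### The one-dimensional setting: lax actions of ordinary monoidal categories. -/

open MonoidalCategory in
/-- A lax action of a monoidal category `M` on a category `D`. -/
structure CatLaxAction (M : Type u₁) [Category.{v₁} M] [MonoidalCategory M] (D : Type u₂)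
    [Category.{v₂} D] where
  ob : M → D → D
  wl : ∀ (P : M) {A B : D}, (A ⟶ B) → (ob P A ⟶ ob P B)
  wr : ∀ {P Q : M}, (P ⟶ Q) → ∀ A : D, ob P A ⟶ ob Q A
  wl_id : ∀ (P : M) (A : D), wl P (𝟙 A) = 𝟙 (ob P A)
  wl_comp : ∀ (P : M) {A B C : D} (f : A ⟶ B) (g : B ⟶ C), wl P (f ≫ g) = wl P f ≫ wl P g
  wr_id : ∀ (P : M) (A : D), wr (𝟙 P) A = 𝟙 (ob P A)
  wr_comp : ∀ {P Q R : M} (p : P ⟶ Q) (q : Q ⟶ R) (A : D), wr (p ≫ q) A = wr p A ≫ wr q A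
  exch : ∀ {P Q : M} (p : P ⟶ Q) {A B : D} (f : A ⟶ B), wl P f ≫ wr p B = wr p A ≫ wl Q f
  β : ∀ (P Q : M) (A : D), ob P (ob Q A) ⟶ ob (P ⊗ Q) A
  β_wl : ∀ (P Q : M) {A B : D} (f : A ⟶ B), wl P (wl Q f) ≫ β P Q B = β P Q A ≫ wl (P ⊗ Q) f
  β_mid : ∀ (P : M) {Q Q' : M} (q : Q ⟶ Q') (A : D),
    wl P (wr q A) ≫ β P Q' A = β P Q A ≫ wr (P ◁ q) A
  β_wr : ∀ {P P' : M} (p : P ⟶ P') (Q : M) (A : D),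
    wr p (ob Q A) ≫ β P' Q A = β P Q A ≫ wr (p ▷ Q) A
  ν : ∀ A : D, A ⟶ ob (𝟙_ M) A
  ν_nat : ∀ {A B : D} (f : A ⟶ B), f ≫ ν B = ν A ≫ wl (𝟙_ M) f
  pentagon : ∀ (P Q R : M) (A : D), wl P (β Q R A) ≫ β P (Q ⊗ R) A =
    β P Q (ob R A) ≫ β (P ⊗ Q) R A ≫ wr (α_ P Q R).hom A
  unitL : ∀ (P : M) (A : D), ν (ob P A) ≫ β (𝟙_ M) P A ≫ wr (λ_ P).hom A = 𝟙 (ob P A)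
  unitR : ∀ (P : M) (A : D), wl P (ν A) ≫ β P (𝟙_ M) A ≫ wr (ρ_ P).hom A = 𝟙 (ob P A)

namespace CatLaxAction

open MonoidalCategory BraidedCategory

section

variable {M : Type u₁} [Category.{v₁} M] [MonoidalCategory M] {D : Type u₂} [Category.{v₂} D]
  (F : CatLaxAction M D)

lemma wr_hom_inv {P Q : M} (e : P ≅ Q) (A : D) : F.wr e.hom A ≫ F.wr e.inv A = 𝟙 _ := by
  rw [← F.wr_comp, e.hom_inv_id, F.wr_id]

/-- The associator of $M$ is moved to the other side of the pentagon. `β` need not be invertible,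
but the action of an isomorphism of $M$ is. -/
lemma pentagon_inv (P Q R : M) (A : D) :
    F.β P Q (F.ob R A) ≫ F.β (P ⊗ Q) R A =
      F.wl P (F.β Q R A) ≫ F.β P (Q ⊗ R) A ≫ F.wr (α_ P Q R).inv A := by
  rw [reassoc_of% F.pentagon, wr_hom_inv, Category.comp_id]

end

variable {M : Type u₁} [Category.{v₁} M] [MonoidalCategory M] [BraidedCategory M]
  {D : Type u₂} [Category.{v₂} D] [MonoidalCategory D]

/-- The laws of a lax monoidal structure with trivial cocycles on a lax action, with unit
`ν : I ⟶ J I`. -/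
structure IsMonoidal (F : CatLaxAction M D)
    (m : ∀ (P : M) (A : D) (Q : M) (B : D), F.ob P A ⊗ F.ob Q B ⟶ F.ob (P ⊗ Q) (A ⊗ B)) :
    Prop where
  nat₁ : ∀ {P P' : M} (p : P ⟶ P') (A : D) (Q : M) (B : D),
    F.wr p A ▷ F.ob Q B ≫ m P' A Q B = m P A Q B ≫ F.wr (p ▷ Q) (A ⊗ B)
  nat₂ : ∀ (P : M) {A A' : D} (f : A ⟶ A') (Q : M) (B : D),
    F.wl P f ▷ F.ob Q B ≫ m P A' Q B = m P A Q B ≫ F.wl (P ⊗ Q) (f ▷ B)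
  nat₃ : ∀ (P : M) (A : D) {Q Q' : M} (q : Q ⟶ Q') (B : D),
    F.ob P A ◁ F.wr q B ≫ m P A Q' B = m P A Q B ≫ F.wr (P ◁ q) (A ⊗ B)
  nat₄ : ∀ (P : M) (A : D) (Q : M) {B B' : D} (g : B ⟶ B'),
    F.ob P A ◁ F.wl Q g ≫ m P A Q B' = m P A Q B ≫ F.wl (P ⊗ Q) (A ◁ g)
  assoc : ∀ (P : M) (A : D) (Q : M) (B : D) (R : M) (C : D),
    m P A Q B ▷ F.ob R C ≫ m (P ⊗ Q) (A ⊗ B) R C ≫ F.wr (α_ P Q R).hom _ ≫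
        F.wl _ (α_ A B C).hom =
      (α_ (F.ob P A) (F.ob Q B) (F.ob R C)).hom ≫ F.ob P A ◁ m Q B R C ≫ m P A (Q ⊗ R) (B ⊗ C)
  unitR : ∀ (P : M) (A : D),
    F.ob P A ◁ F.ν (𝟙_ D) ≫ m P A (𝟙_ M) (𝟙_ D) ≫ F.wr (ρ_ P).hom _ ≫ F.wl P (ρ_ A).hom =
      (ρ_ (F.ob P A)).hom
  unitL : ∀ (P : M) (A : D),
    F.ν (𝟙_ D) ▷ F.ob P A ≫ m (𝟙_ M) (𝟙_ D) P A ≫ F.wr (λ_ P).hom _ ≫ F.wl P (λ_ A).hom =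
      (λ_ (F.ob P A)).hom
  β2 : ∀ (P Q : M) (A : D) (R S : M) (B : D),
    (F.β P Q A ⊗ₘ F.β R S B) ≫ m (P ⊗ Q) A (R ⊗ S) B ≫ F.wr (tensorμ P Q R S) (A ⊗ B) =
      m P (F.ob Q A) R (F.ob S B) ≫ F.wl (P ⊗ R) (m Q A S B) ≫ F.β (P ⊗ R) (Q ⊗ S) (A ⊗ B)
  ν2 : ∀ A B : D, F.ν (A ⊗ B) =
    (F.ν A ⊗ₘ F.ν B) ≫ m (𝟙_ M) A (𝟙_ M) B ≫ F.wr (λ_ (𝟙_ M)).hom (A ⊗ B)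

/-- The laws of a bistrong commutative lax action. -/
structure IsBistrongCommutative (F : CatLaxAction M D)
    (t : ∀ (P : M) (A B : D), A ⊗ F.ob P B ⟶ F.ob P (A ⊗ B))
    (s : ∀ (P : M) (A B : D), F.ob P A ⊗ B ⟶ F.ob P (A ⊗ B)) : Prop where
  t_nat₁ : ∀ {P P' : M} (p : P ⟶ P') (A B : D),
    A ◁ F.wr p B ≫ t P' A B = t P A B ≫ F.wr p (A ⊗ B)
  t_nat₂ : ∀ (P : M) {A A' : D} (f : A ⟶ A') (B : D),
    f ▷ F.ob P B ≫ t P A' B = t P A B ≫ F.wl P (f ▷ B)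
  t_nat₃ : ∀ (P : M) (A : D) {B B' : D} (g : B ⟶ B'),
    A ◁ F.wl P g ≫ t P A B' = t P A B ≫ F.wl P (A ◁ g)
  s_nat₁ : ∀ {P P' : M} (p : P ⟶ P') (A B : D),
    F.wr p A ▷ B ≫ s P' A B = s P A B ≫ F.wr p (A ⊗ B)
  s_nat₂ : ∀ (P : M) {A A' : D} (f : A ⟶ A') (B : D),
    F.wl P f ▷ B ≫ s P A' B = s P A B ≫ F.wl P (f ▷ B)
  s_nat₃ : ∀ (P : M) (A : D) {B B' : D} (g : B ⟶ B'),
    F.ob P A ◁ g ≫ s P A B' = s P A B ≫ F.wl P (A ◁ g)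
  tx : ∀ (P : M) (A : D), (λ_ (F.ob P A)).hom = t P (𝟙_ D) A ≫ F.wl P (λ_ A).hom
  ty : ∀ (P : M) (A B C : D), t P (A ⊗ B) C ≫ F.wl P (α_ A B C).hom =
    (α_ A B (F.ob P C)).hom ≫ A ◁ t P B C ≫ t P A (B ⊗ C)
  tw : ∀ (P Q : M) (A B : D), A ◁ F.β P Q B ≫ t (P ⊗ Q) A B =
    t P A (F.ob Q B) ≫ F.wl P (t Q A B) ≫ F.β P Q (A ⊗ B)
  tz : ∀ A B : D, F.ν (A ⊗ B) = A ◁ F.ν B ≫ t (𝟙_ M) A B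
  sx : ∀ (P : M) (A : D), (ρ_ (F.ob P A)).hom = s P A (𝟙_ D) ≫ F.wl P (ρ_ A).hom
  sy : ∀ (P : M) (A B C : D),
    s P A B ▷ C ≫ s P (A ⊗ B) C ≫ F.wl P (α_ A B C).hom =
      (α_ (F.ob P A) B C).hom ≫ s P A (B ⊗ C)
  sw : ∀ (P Q : M) (A B : D), F.β P Q A ▷ B ≫ s (P ⊗ Q) A B =
    s P (F.ob Q A) B ≫ F.wl P (s Q A B) ≫ F.β P Q (A ⊗ B)
  sz : ∀ A B : D, F.ν (A ⊗ B) = F.ν A ▷ B ≫ s (𝟙_ M) A B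
  q : ∀ (P : M) (A B C : D),
    (α_ A (F.ob P B) C).hom ≫ A ◁ s P B C ≫ t P A (B ⊗ C) =
      t P A B ▷ C ≫ s P (A ⊗ B) C ≫ F.wl P (α_ A B C).hom
  c : ∀ (P : M) (A : D) (Q : M) (B : D),
    t Q (F.ob P A) B ≫ F.wl Q (s P A B) ≫ F.β Q P (A ⊗ B) =
      s P A (F.ob Q B) ≫ F.wl P (t Q A B) ≫ F.β P Q (A ⊗ B) ≫ F.wr (β_ P Q).hom (A ⊗ B)

variable {F : CatLaxAction M D}

end CatLaxAction

/-! ### From a commutative pair of strengths to a multiplication. -/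

namespace CatLaxAction
open MonoidalCategory BraidedCategory

variable {M : Type u₁} [Category.{v₁} M] [MonoidalCategory M]
  {D : Type u₂} [Category.{v₂} D] [MonoidalCategory D]

/-- The multiplication `(P A) (Q B) ⟶ (P Q) (A B)` obtained from a left and a right strength. -/
abbrev mulOf (F : CatLaxAction M D) (t : ∀ (P : M) (A B : D), A ⊗ F.ob P B ⟶ F.ob P (A ⊗ B))
    (s : ∀ (P : M) (A B : D), F.ob P A ⊗ B ⟶ F.ob P (A ⊗ B)) (P : M) (A : D) (Q : M) (B : D) :
    F.ob P A ⊗ F.ob Q B ⟶ F.ob (P ⊗ Q) (A ⊗ B) :=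
  s P A (F.ob Q B) ≫ F.wl P (t Q A B) ≫ F.β P Q (A ⊗ B)

namespace IsBistrongCommutative

variable [BraidedCategory M] {F : CatLaxAction M D}
  {t : ∀ (P : M) (A B : D), A ⊗ F.ob P B ⟶ F.ob P (A ⊗ B)}
  {s : ∀ (P : M) (A B : D), F.ob P A ⊗ B ⟶ F.ob P (A ⊗ B)}

/-- Naturality moves $\nu_I$ past $s$, where it merges with $t^J$ into $\nu_{AI}$ under $P$. The
right unit axiom of the action then cancels `β`, and the unit law of $s$ remains. -/
lemma mulOf_unitR (H : F.IsBistrongCommutative t s) (P : M) (A : D) :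
    F.ob P A ◁ F.ν (𝟙_ D) ≫ F.mulOf t s P A (𝟙_ M) (𝟙_ D) ≫ F.wr (ρ_ P).hom _ ≫
      F.wl P (ρ_ A).hom = (ρ_ (F.ob P A)).hom := by
  simp only [mulOf, Category.assoc]
  rw [reassoc_of% H.s_nat₃, ← reassoc_of% F.wl_comp, ← H.tz, reassoc_of% F.unitR, ← H.sx]

/-- Here $\nu_I$ meets $s^J$ at once and becomes $\nu_{I(PA)}$. Naturality of `ν` lets it pass $t$,
and the left unit axiom of the action cancels it. -/
lemma mulOf_unitL (H : F.IsBistrongCommutative t s) (P : M) (A : D) :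
    F.ν (𝟙_ D) ▷ F.ob P A ≫ F.mulOf t s (𝟙_ M) (𝟙_ D) P A ≫ F.wr (λ_ P).hom _ ≫
      F.wl P (λ_ A).hom = (λ_ (F.ob P A)).hom := by
  simp only [mulOf, Category.assoc]
  rw [← reassoc_of% H.sz, ← reassoc_of% F.ν_nat, reassoc_of% F.unitL, ← H.tx]

/-- The inner `ν` is absorbed by $t$ and cancelled by the right unit axiom, which applies because
$\lambda_J=\rho_J$; the outer one is absorbed by $s$. -/
lemma mulOf_ν2 (H : F.IsBistrongCommutative t s) (A B : D) : F.ν (A ⊗ B) =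
    (F.ν A ⊗ₘ F.ν B) ≫ F.mulOf t s (𝟙_ M) A (𝟙_ M) B ≫ F.wr (λ_ (𝟙_ M)).hom (A ⊗ B) := by
  simp only [mulOf, Category.assoc, MonoidalCategory.tensorHom_def]
  rw [reassoc_of% H.s_nat₃, ← reassoc_of% F.wl_comp, ← H.tz, unitors_equal, F.unitR,
    Category.comp_id, H.sz]

lemma mulOf_assoc (H : F.IsBistrongCommutative t s) (P : M) (A : D) (Q : M) (B : D) (R : M)
    (C : D) :
    F.mulOf t s P A Q B ▷ F.ob R C ≫ F.mulOf t s (P ⊗ Q) (A ⊗ B) R C ≫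
        F.wr (α_ P Q R).hom _ ≫ F.wl _ (α_ A B C).hom =
      (α_ (F.ob P A) (F.ob Q B) (F.ob R C)).hom ≫ F.ob P A ◁ F.mulOf t s Q B R C ≫
        F.mulOf t s P A (Q ⊗ R) (B ⊗ C) := by
  -- The part of the law that happens under the outer actor $P$: the multiplication of $QB$ and $RC$
  -- commutes with tensoring by $A$ on the left. This is where the bistrength and the laws of $t$
  -- are used; what is left concerns only $s$ and the pentagon.
  have key : t Q A B ▷ F.ob R C ≫ s Q (A ⊗ B) (F.ob R C) ≫ F.wl Q (t R (A ⊗ B) C) ≫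
      F.β Q R _ ≫ F.wl (Q ⊗ R) (α_ A B C).hom =
      (α_ A (F.ob Q B) (F.ob R C)).hom ≫ A ◁ F.mulOf t s Q B R C ≫ t (Q ⊗ R) A (B ⊗ C) := by
    rw [← F.β_wl, ← reassoc_of% F.wl_comp, H.ty]
    simp only [F.wl_comp, mulOf, Category.assoc, MonoidalCategory.whiskerLeft_comp]
    rw [H.tw, reassoc_of% H.t_nat₃, reassoc_of% H.q]
  calc _ = s P A (F.ob Q B) ▷ F.ob R C ≫ s P (A ⊗ F.ob Q B) (F.ob R C) ≫
        F.wl P (t Q A B ▷ F.ob R C ≫ s Q (A ⊗ B) (F.ob R C) ≫ F.wl Q (t R (A ⊗ B) C) ≫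
      F.β Q R _ ≫ F.wl (Q ⊗ R) (α_ A B C).hom) ≫ F.β P (Q ⊗ R) _ := by
        simp only [mulOf, comp_whiskerRight, F.wl_comp, Category.assoc]
        rw [reassoc_of% H.sw, ← reassoc_of% F.β_wl, F.β_wl, reassoc_of% H.s_nat₂,
          ← reassoc_of% F.pentagon]
    _ = _ := by
        rw [key]
        simp only [F.wl_comp, Category.assoc]
        rw [reassoc_of% H.sy, ← reassoc_of% H.s_nat₃]

lemma mulOf_β2 (H : F.IsBistrongCommutative t s) (P Q : M) (A : D) (R S : M) (B : D) :
    (F.β P Q A ⊗ₘ F.β R S B) ≫ F.mulOf t s (P ⊗ Q) A (R ⊗ S) B ≫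
        F.wr (tensorμ P Q R S) (A ⊗ B) =
      F.mulOf t s P (F.ob Q A) R (F.ob S B) ≫ F.wl (P ⊗ R) (F.mulOf t s Q A S B) ≫
        F.β (P ⊗ R) (Q ⊗ S) (A ⊗ B) := by
  -- The exchange of $Q$ and $R$ under the outer actor $P$. Commutativity turns
  -- $t^R;Rs^Q;\beta_{R,Q}$ into $s^Q;Qt^R;\beta_{Q,R}$ followed by the braiding; the pentagon
  -- brings $\beta_{R,Q}$ next to it beforehand, and the law of $t$ for `β` then merges $R$ and $S$.
  have key : t R (F.ob Q A) (F.ob S B) ≫ F.wl R (F.mulOf t s Q A S B) ≫ F.β R (Q ⊗ S) (A ⊗ B) =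
      F.ob Q A ◁ F.β R S B ≫ s Q A (F.ob (R ⊗ S) B) ≫ F.wl Q (t (R ⊗ S) A B) ≫
        F.β Q (R ⊗ S) (A ⊗ B) ≫
          F.wr ((α_ Q R S).inv ≫ (β_ Q R).hom ▷ S ≫ (α_ R Q S).hom) (A ⊗ B) := by
    simp only [F.wl_comp, F.wr_comp, Category.assoc]
    rw [F.pentagon, reassoc_of% F.β_wl, reassoc_of% H.c, reassoc_of% H.s_nat₃,
      ← reassoc_of% F.wl_comp, H.tw, ← reassoc_of% F.exch, reassoc_of% F.β_wr]
    simp only [F.wl_comp, Category.assoc]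
    rw [← reassoc_of% F.pentagon_inv, reassoc_of% F.β_wl]
  calc _ = s P (F.ob Q A) (F.ob R (F.ob S B)) ≫ F.wl P (F.ob Q A ◁ F.β R S B ≫
        s Q A (F.ob (R ⊗ S) B) ≫ F.wl Q (t (R ⊗ S) A B) ≫ F.β Q (R ⊗ S) (A ⊗ B) ≫
          F.wr ((α_ Q R S).inv ≫ (β_ Q R).hom ▷ S ≫ (α_ R Q S).hom) (A ⊗ B)) ≫
          F.β P (R ⊗ (Q ⊗ S)) (A ⊗ B) ≫ F.wr (α_ P R (Q ⊗ S)).inv (A ⊗ B) := by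
        have : tensorμ P Q R S = (α_ P Q (R ⊗ S)).hom ≫
            (P ◁ ((α_ Q R S).inv ≫ (β_ Q R).hom ▷ S ≫ (α_ R Q S).hom)) ≫
              (α_ P R (Q ⊗ S)).inv := by simp [tensorμ]
        rw [this]
        -- From here on only naturality of `β` in its middle actor is used, so the exchange map is
        -- kept opaque and `F.wr_comp` cannot break it up.
        generalize (α_ Q R S).inv ≫ (β_ Q R).hom ▷ S ≫ (α_ R Q S).hom = ψ
        simp only [F.wl_comp, F.wr_comp, Category.assoc, mulOf, MonoidalCategory.tensorHom_def']
        rw [reassoc_of% F.β_mid, ← reassoc_of% H.s_nat₃, reassoc_of% H.sw,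
          reassoc_of% F.pentagon, ← reassoc_of% F.β_wl]
    _ = _ := by
        rw [← key]
        simp only [mulOf, F.wl_comp, Category.assoc]
        rw [← F.pentagon_inv]
        simp only [reassoc_of% F.β_wl]

lemma isMonoidal (H : F.IsBistrongCommutative t s) : F.IsMonoidal (F.mulOf t s) where
  nat₁ p A Q B := by
    simp only [mulOf, Category.assoc]
    rw [reassoc_of% H.s_nat₁, ← reassoc_of% F.exch, F.β_wr]
  nat₂ P _ _ f Q B := by
    simp only [mulOf, Category.assoc]
    rw [reassoc_of% H.s_nat₂, ← reassoc_of% F.wl_comp, H.t_nat₂, F.wl_comp, Category.assoc, F.β_wl]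
  nat₃ P A _ _ q B := by
    simp only [mulOf, Category.assoc]
    rw [reassoc_of% H.s_nat₃, ← reassoc_of% F.wl_comp, H.t_nat₁, F.wl_comp, Category.assoc,
      F.β_mid]
  nat₄ P A Q _ _ g := by
    simp only [mulOf, Category.assoc]
    rw [reassoc_of% H.s_nat₃, ← reassoc_of% F.wl_comp, H.t_nat₃, F.wl_comp, Category.assoc, F.β_wl]
  assoc := H.mulOf_assoc
  unitR := H.mulOf_unitR
  unitL := H.mulOf_unitL
  β2 := H.mulOf_β2
  ν2 := H.mulOf_ν2

end IsBistrongCommutative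
end CatLaxAction

/-! ### From a multiplication to a commutative pair of strengths. -/

namespace CatLaxAction
open MonoidalCategory BraidedCategory

variable {M : Type u₁} [Category.{v₁} M] [MonoidalCategory M]
  {D : Type u₂} [Category.{v₂} D] [MonoidalCategory D]

section

variable (F : CatLaxAction M D)
  (m : ∀ (P : M) (A : D) (Q : M) (B : D), F.ob P A ⊗ F.ob Q B ⟶ F.ob (P ⊗ Q) (A ⊗ B))

/-- The left strength obtained from a lax monoidal structure. -/
abbrev leftStrengthOf (P : M) (A B : D) : A ⊗ F.ob P B ⟶ F.ob P (A ⊗ B) :=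
  F.ν A ▷ F.ob P B ≫ m (𝟙_ M) A P B ≫ F.wr (λ_ P).hom (A ⊗ B)

/-- The right strength obtained from a lax monoidal structure. -/
abbrev rightStrengthOf (P : M) (A B : D) : F.ob P A ⊗ B ⟶ F.ob P (A ⊗ B) :=
  F.ob P A ◁ F.ν B ≫ m P A (𝟙_ M) B ≫ F.wr (ρ_ P).hom (A ⊗ B)

end

namespace IsMonoidal

variable [BraidedCategory M] {F : CatLaxAction M D}
  {m : ∀ (P : M) (A : D) (Q : M) (B : D), F.ob P A ⊗ F.ob Q B ⟶ F.ob (P ⊗ Q) (A ⊗ B)}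

lemma nat (H : F.IsMonoidal m) {P P' Q Q' : M} (p : P ⟶ P') (q : Q ⟶ Q') (A B : D) :
    m P A Q B ≫ F.wr (p ⊗ₘ q) (A ⊗ B) = (F.wr p A ⊗ₘ F.wr q B) ≫ m P' A Q' B := by
  rw [MonoidalCategory.tensorHom_def, MonoidalCategory.tensorHom_def, F.wr_comp, Category.assoc,
    H.nat₃, reassoc_of% H.nat₁]

lemma assoc' (H : F.IsMonoidal m) (P : M) (A : D) (Q : M) (B : D) (R : M) (C : D) :
    m P A Q B ▷ F.ob R C ≫ m (P ⊗ Q) (A ⊗ B) R C ≫ F.wl _ (α_ A B C).hom ≫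
        F.wr (α_ P Q R).hom _ =
      (α_ (F.ob P A) (F.ob Q B) (F.ob R C)).hom ≫ F.ob P A ◁ m Q B R C ≫
        m P A (Q ⊗ R) (B ⊗ C) := by
  rw [F.exch, H.assoc]

/-- Associativity of `m` with actors $J,J,P$. The $\nu^2$ law rewrites $\nu_{AB}$ as a product of
$\nu_A$ and $\nu_B$, which creates the second $J$. -/
lemma left_assoc (H : F.IsMonoidal m) (P : M) (A B C : D) :
    F.leftStrengthOf m P (A ⊗ B) C ≫ F.wl P (α_ A B C).hom =
      (α_ A B (F.ob P C)).hom ≫ A ◁ F.leftStrengthOf m P B C ≫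
        F.leftStrengthOf m P A (B ⊗ C) := by
  -- Once naturality has collected the unitors at the end, this coherence in $M$ exposes the
  -- associator that the associativity law of `m` requires.
  have e : (λ_ (𝟙_ M)).hom ▷ P ≫ (λ_ P).hom =
      (α_ _ _ _).hom ≫ 𝟙_ M ◁ (λ_ P).hom ≫ (λ_ P).hom := by simp
  simp only [Category.assoc]
  rw [H.ν2, ← F.exch]
  simp only [comp_whiskerRight, MonoidalCategory.whiskerLeft_comp, Category.assoc]
  rw [reassoc_of% H.nat₁, ← reassoc_of% F.exch, ← F.wr_comp, e]
  simp only [F.wr_comp]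
  rw [reassoc_of% H.assoc', ← reassoc_of% H.nat₃]
  simp only [whisker_exchange_assoc]
  simp [MonoidalCategory.tensorHom_def]

/-- The mirror case: associativity of `m` with actors $P,J,J$, after $\nu_{BC}$ is split by the
$\nu^2$ law. -/
lemma right_assoc (H : F.IsMonoidal m) (P : M) (A B C : D) :
    F.rightStrengthOf m P A B ▷ C ≫ F.rightStrengthOf m P (A ⊗ B) C ≫ F.wl P (α_ A B C).hom =
      (α_ (F.ob P A) B C).hom ≫ F.rightStrengthOf m P A (B ⊗ C) := by
  have e : (ρ_ P).hom ▷ 𝟙_ M ≫ (ρ_ P).hom =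
      (α_ P (𝟙_ M) (𝟙_ M)).hom ≫ P ◁ (λ_ (𝟙_ M)).hom ≫ (ρ_ P).hom := by simp
  simp only [rightStrengthOf, Category.assoc]
  rw [H.ν2 B C, ← F.exch]
  simp only [comp_whiskerRight, MonoidalCategory.whiskerLeft_comp, Category.assoc]
  rw [← whisker_exchange_assoc (F.wr (ρ_ P).hom (A ⊗ B)), ← whisker_exchange_assoc (m P A _ B),
    reassoc_of% H.nat₁, ← reassoc_of% F.exch, ← F.wr_comp, e]
  simp only [F.wr_comp]
  rw [reassoc_of% H.assoc', ← reassoc_of% H.nat₃]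
  simp [MonoidalCategory.tensorHom_def]

/-- Associativity of `m` with actors $J,P,J$. Each outer object contributes its own `ν`, so the
$\nu^2$ law plays no role. -/
lemma bistrong (H : F.IsMonoidal m) (P : M) (A B C : D) :
    (α_ A (F.ob P B) C).hom ≫ A ◁ F.rightStrengthOf m P B C ≫ F.leftStrengthOf m P A (B ⊗ C) =
      F.leftStrengthOf m P A B ▷ C ≫ F.rightStrengthOf m P (A ⊗ B) C ≫
        F.wl P (α_ A B C).hom := by
  have e : (λ_ P).hom ▷ 𝟙_ M ≫ (ρ_ P).hom =
      (α_ _ _ _).hom ≫ 𝟙_ M ◁ (ρ_ P).hom ≫ (λ_ P).hom := by simp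
  simp only [comp_whiskerRight, MonoidalCategory.whiskerLeft_comp, Category.assoc]
  rw [← F.exch, ← whisker_exchange_assoc (F.wr (λ_ P).hom (A ⊗ B)),
    ← whisker_exchange_assoc (m _ A _ B),
    reassoc_of% H.nat₁, ← reassoc_of% F.exch, ← F.wr_comp, e]
  simp only [F.wr_comp]
  rw [reassoc_of% H.assoc', ← reassoc_of% H.nat₃]
  simp only [whisker_exchange_assoc]
  simp

/-- A strength built from `m` has the shape $(x\otimes y);m;F(p)$, where one of $x,y$ is a component
of `ν`, the other an identity, and $p$ is a unitor. When two such maps are nested and closed by `β`,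
naturality moves $a,b$ in front of the outer `m` and $p,q$ behind `β`. The $\beta^2$ law then fuses
the two multiplications into one, at the cost of an interchanger. The next four lemmas are instances
in which unit actors make that interchanger simple. -/
lemma nested (H : F.IsMonoidal m) {P Q R S P' Q' : M} {A A' B B' X Y : D}
    (p : P ⊗ R ⟶ P') (q : Q ⊗ S ⟶ Q') (x : X ⟶ F.ob P A') (a : A' ⟶ F.ob Q A)
    (y : Y ⟶ F.ob R B') (b : B' ⟶ F.ob S B) :
    ((x ⊗ₘ y) ≫ m P A' R B' ≫ F.wr p _) ≫ F.wl P' ((a ⊗ₘ b) ≫ m Q A S B ≫ F.wr q _) ≫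
        F.β P' Q' (A ⊗ B) =
      ((x ≫ F.wl P a ≫ F.β P Q A) ⊗ₘ (y ≫ F.wl R b ≫ F.β R S B)) ≫
        m (P ⊗ Q) A (R ⊗ S) B ≫ F.wr (tensorμ P Q R S ≫ (p ⊗ₘ q)) (A ⊗ B) := by
  -- Naturality of `m` in its two arguments from $D$.
  have e : (x ⊗ₘ y) ≫ m P A' R B' ≫ F.wl (P ⊗ R) (a ⊗ₘ b) =
      ((x ≫ F.wl P a) ⊗ₘ (y ≫ F.wl R b)) ≫ m P (F.ob Q A) R (F.ob S B) := by
    rw [← MonoidalCategory.tensorHom_comp_tensorHom, MonoidalCategory.tensorHom_def a,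
      MonoidalCategory.tensorHom_def (F.wl P a), F.wl_comp, Category.assoc, Category.assoc, H.nat₄,
      reassoc_of% H.nat₂]
  simp only [Category.assoc]
  rw [F.wl_comp, F.wl_comp, Category.assoc, Category.assoc, F.β_mid, ← reassoc_of% F.exch,
    ← reassoc_of% F.exch, reassoc_of% e, reassoc_of% F.β_wr, ← F.wr_comp,
    ← MonoidalCategory.tensorHom_def, F.wr_comp, ← reassoc_of% H.β2]
  simp only [← MonoidalCategory.tensorHom_comp_tensorHom, Category.assoc]

/-- `nested` with both left-hand actors equal to $J$. It leaves $\nu_A;J\nu_A;\beta_{J,J,A}$ on the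
left factor, and the right unit axiom collapses this to $\nu_A$ because $\lambda_J=\rho_J$. -/
lemma left_β (H : F.IsMonoidal m) (P Q : M) (A B : D) :
    A ◁ F.β P Q B ≫ F.leftStrengthOf m (P ⊗ Q) A B =
      F.leftStrengthOf m P A (F.ob Q B) ≫ F.wl P (F.leftStrengthOf m Q A B) ≫
        F.β P Q (A ⊗ B) := by
  have k := H.nested (λ_ P).hom (λ_ Q).hom (F.ν A) (F.ν A) (𝟙 (F.ob P (F.ob Q B)))
    (𝟙 (F.ob Q B))
  -- The left unit law for the tensor product of $M$ as a monoidal functor: the factor $\lambda_J$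
  -- it releases is the one that collapses the doubled `ν`.
  have e : tensorμ (𝟙_ M) (𝟙_ M) P Q ≫ ((λ_ P).hom ⊗ₘ (λ_ Q).hom) =
      ((λ_ (𝟙_ M)).hom ⊗ₘ 𝟙 _) ≫ (λ_ (P ⊗ Q)).hom := by
    rw [tensor_left_unitality]; simp
  rw [MonoidalCategory.tensorHom_id, MonoidalCategory.tensorHom_id] at k
  rw [k, e, F.wr_comp, reassoc_of% H.nat, MonoidalCategory.tensorHom_comp_tensorHom_assoc,
    unitors_equal, Category.assoc, Category.assoc, F.unitR, F.wl_id, F.wr_id]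
  simp [MonoidalCategory.tensorHom_def']

lemma right_β (H : F.IsMonoidal m) (P Q : M) (A B : D) :
    F.β P Q A ▷ B ≫ F.rightStrengthOf m (P ⊗ Q) A B =
      F.rightStrengthOf m P (F.ob Q A) B ≫ F.wl P (F.rightStrengthOf m Q A B) ≫
        F.β P Q (A ⊗ B) := by
  have k := H.nested (ρ_ P).hom (ρ_ Q).hom (𝟙 (F.ob P (F.ob Q A))) (𝟙 (F.ob Q A))
    (F.ν B) (F.ν B)
  have e : tensorμ P Q (𝟙_ M) (𝟙_ M) ≫ ((ρ_ P).hom ⊗ₘ (ρ_ Q).hom) =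
      (𝟙 _ ⊗ₘ (λ_ (𝟙_ M)).hom) ≫ (ρ_ (P ⊗ Q)).hom := by
    rw [tensor_right_unitality]; simp
  rw [MonoidalCategory.id_tensorHom, MonoidalCategory.id_tensorHom] at k
  rw [k, e, F.wr_comp, reassoc_of% H.nat, MonoidalCategory.tensorHom_comp_tensorHom_assoc,
    unitors_equal, Category.assoc, Category.assoc, Category.assoc, Category.assoc, F.unitR,
    F.wl_id, F.wr_id]
  simp [MonoidalCategory.tensorHom_def]

/-- `nested` with the two inner actors equal to $J$: the interchanger braids $J$ with itself, which
is trivial, and the two unit axioms of the action cancel the two copies of `ν`. -/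
lemma right_left (H : F.IsMonoidal m) (P : M) (A : D) (Q : M) (B : D) :
    F.rightStrengthOf m P A (F.ob Q B) ≫ F.wl P (F.leftStrengthOf m Q A B) ≫ F.β P Q (A ⊗ B) =
      m P A Q B := by
  have k := H.nested (ρ_ P).hom (λ_ Q).hom (𝟙 (F.ob P A)) (F.ν A)
    (F.ν (F.ob Q B)) (𝟙 (F.ob Q B))
  have e : tensorμ P (𝟙_ M) (𝟙_ M) Q ≫ ((ρ_ P).hom ⊗ₘ (λ_ Q).hom) =
      ((ρ_ P).hom ⊗ₘ (λ_ Q).hom) := by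
    -- Without this the remaining identity would involve a braiding and would not be a matter of
    -- monoidal coherence.
    have b : (β_ (𝟙_ M) (𝟙_ M)).hom = 𝟙 _ := by
      rw [braiding_tensorUnit_left, unitors_equal, Iso.hom_inv_id]
    rw [tensorμ, b]
    monoidal
  rw [MonoidalCategory.id_tensorHom, MonoidalCategory.tensorHom_id] at k
  rw [k, e, H.nat, MonoidalCategory.tensorHom_comp_tensorHom_assoc]
  simp [F.wl_id, F.unitL, F.unitR]

/-- `nested` with the two outer actors equal to $J$: now the interchanger exchanges $P$ and $Q$, so
up to unitors it is the braiding itself. -/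
lemma left_right (H : F.IsMonoidal m) (P : M) (A : D) (Q : M) (B : D) :
    F.leftStrengthOf m Q (F.ob P A) B ≫ F.wl Q (F.rightStrengthOf m P A B) ≫ F.β Q P (A ⊗ B) =
      m P A Q B ≫ F.wr (β_ P Q).hom (A ⊗ B) := by
  have k := H.nested (λ_ Q).hom (ρ_ P).hom (F.ν (F.ob P A)) (𝟙 (F.ob P A))
    (𝟙 (F.ob Q B)) (F.ν B)
  have e : tensorμ (𝟙_ M) P Q (𝟙_ M) ≫ ((λ_ Q).hom ⊗ₘ (ρ_ P).hom) =
      ((λ_ P).hom ⊗ₘ (ρ_ Q).hom) ≫ (β_ P Q).hom := by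
    rw [tensorμ]
    monoidal
  rw [MonoidalCategory.id_tensorHom, MonoidalCategory.tensorHom_id] at k
  rw [k, e, F.wr_comp, reassoc_of% H.nat, MonoidalCategory.tensorHom_comp_tensorHom_assoc]
  simp [F.wl_id, F.unitL, F.unitR]

lemma isBistrongCommutative (H : F.IsMonoidal m) :
    F.IsBistrongCommutative (F.leftStrengthOf m) (F.rightStrengthOf m) where
  t_nat₁ p A B := by
    simp only [Category.assoc]
    rw [whisker_exchange_assoc, reassoc_of% H.nat₃, ← F.wr_comp, ← F.wr_comp,
      leftUnitor_naturality]
  t_nat₂ P _ _ f B := by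
    simp only [Category.assoc]
    rw [← F.exch, ← reassoc_of% H.nat₂, ← comp_whiskerRight_assoc, F.ν_nat,
      comp_whiskerRight_assoc]
  t_nat₃ P A _ _ g := by
    simp only [Category.assoc]
    rw [← F.exch, ← reassoc_of% H.nat₄, whisker_exchange_assoc]
  s_nat₁ p A B := by
    simp only [Category.assoc]
    rw [← whisker_exchange_assoc, reassoc_of% H.nat₁, ← F.wr_comp, ← F.wr_comp,
      rightUnitor_naturality]
  s_nat₂ P _ _ f B := by
    simp only [Category.assoc]
    rw [← F.exch, ← reassoc_of% H.nat₂, whisker_exchange_assoc]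
  s_nat₃ P A _ _ g := by
    simp only [Category.assoc]
    rw [← F.exch, ← reassoc_of% H.nat₄, ← MonoidalCategory.whiskerLeft_comp_assoc, F.ν_nat,
      MonoidalCategory.whiskerLeft_comp_assoc]
  tx P A := by simp only [Category.assoc, H.unitL]
  ty := H.left_assoc
  tw := H.left_β
  tz A B := by rw [H.ν2, MonoidalCategory.tensorHom_def', Category.assoc]
  sx P A := by simp only [Category.assoc, H.unitR]
  sy := H.right_assoc
  sw := H.right_β
  sz A B := by rw [H.ν2, MonoidalCategory.tensorHom_def, Category.assoc, unitors_equal]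
  q := H.bistrong
  c P A Q B := by
    -- Both sides of commutativity are `m` followed by the braiding.
    rw [H.left_right, ← H.right_left]; simp only [Category.assoc]

end IsMonoidal
end CatLaxAction

/-! ### The two braided monoidal categories inside a braided vertically monoidal double category. -/

/-- The 1h-cells of a double category, the objects of a category whose morphisms are the 2-cells
under vertical composition. -/
structure HArrow (D : Type u) [DoubleCategory.{z, w, v, u} D] where
  {src tgt : D}
  hom : HHom src tgt

instance HArrow.instCategory (D : Type u) [DoubleCategory.{z, w, v, u} D] :
    Category (HArrow D) where
  Hom f g := Cell f.hom g.hom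
  id f := vid f.hom
  comp a b := a ≫ᵥ b
  id_comp a := vid_vcomp a
  comp_id a := vcomp_vid a
  assoc a b c := vcomp_assoc a b c

namespace VMonoidal

variable {D : Type u} [DoubleCategory.{z, w, v, u} D] (𝓓 : VMonoidal D)

/-- The monoidal category of objects and 1v-cells. -/
@[reducible] def monoidal₀ : MonoidalCategory D :=
  letI : MonoidalCategoryStruct D :=
    { tensorObj := 𝓓.T.o
      whiskerLeft := fun A _ _ f => 𝓓.T.v (𝟙 A) f
      whiskerRight := fun f B => 𝓓.T.v f (𝟙 B)
      tensorHom := fun f g => 𝓓.T.v f g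
      tensorUnit := 𝓓.I₀
      associator := fun A B C => ⟨𝓓.α₀ A B C, 𝓓.αi₀ A B C, 𝓓.α.app_hom_inv _, 𝓓.α.app_inv_hom _⟩
      leftUnitor := fun A => ⟨𝓓.lam₀ A, 𝓓.lam.inv.app A, 𝓓.lam.app_hom_inv _, 𝓓.lam.app_inv_hom _⟩
      rightUnitor := fun A =>
        ⟨𝓓.rho₀ A, 𝓓.rho.inv.app A, 𝓓.rho.app_hom_inv _, 𝓓.rho.app_inv_hom _⟩ }
  MonoidalCategory.ofTensorHom
    (id_tensorHom_id := fun A B => 𝓓.T.map_id (A, B))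
    (tensorHom_comp_tensorHom := fun f₁ f₂ g₁ g₂ =>
      (𝓓.T.map_comp (X := (_, _)) (Y := (_, _)) (Z := (_, _)) (f₁, f₂) (g₁, g₂)).symm)
    (associator_naturality := fun f g h =>
      𝓓.α.hom.app_naturality (A := (_, (_, _))) (A' := (_, (_, _))) (f, (g, h)))
    (leftUnitor_naturality := fun f => by
      have := 𝓓.lam.hom.app_naturality f
      refine Eq.trans ?_ this
      -- The constant functor sends a 1v-cell to `𝓓.I.map (𝟙 _)`, which is an identity only by
      -- functoriality of `I`.
      change 𝓓.T.v _ _ ≫ _ = 𝓓.T.v (𝓓.I.map (𝟙 _)) _ ≫ _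
      rw [𝓓.I.map_id]
      rfl)
    (rightUnitor_naturality := fun f => by
      have := 𝓓.rho.hom.app_naturality f
      refine Eq.trans ?_ this
      change 𝓓.T.v _ _ ≫ _ = 𝓓.T.v _ (𝓓.I.map (𝟙 _)) ≫ _
      rw [𝓓.I.map_id]
      rfl)
    (pentagon := 𝓓.pentagon₀)
    (triangle := 𝓓.triangle₀)

/-- The monoidal category of 1h-cells and 2-cells. -/
@[reducible] def monoidal₁ : MonoidalCategory (HArrow D) :=
  letI : MonoidalCategoryStruct (HArrow D) :=
    { tensorObj := fun f g => ⟨𝓓.T.h f.hom g.hom⟩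
      whiskerLeft := fun f _ _ a => 𝓓.T.c (vid f.hom) a
      whiskerRight := fun a f => 𝓓.T.c a (vid f.hom)
      tensorHom := fun a b => 𝓓.T.c a b
      tensorUnit := ⟨𝓓.I₁⟩
      associator := fun f g h => ⟨𝓓.α₁ f.hom g.hom h.hom, 𝓓.αi₁ f.hom g.hom h.hom,
        𝓓.α.cell_hom_inv _, 𝓓.α.cell_inv_hom _⟩
      leftUnitor := fun f =>
        ⟨𝓓.lam₁ f.hom, 𝓓.lam.inv.cell f.hom, 𝓓.lam.cell_hom_inv _, 𝓓.lam.cell_inv_hom _⟩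
      rightUnitor := fun f =>
        ⟨𝓓.rho₁ f.hom, 𝓓.rho.inv.cell f.hom, 𝓓.rho.cell_hom_inv _, 𝓓.rho.cell_inv_hom _⟩ }
  MonoidalCategory.ofTensorHom
    (id_tensorHom_id := fun f g => 𝓓.T.cmap_vid (A := (_, _)) (B := (_, _)) (f.hom, g.hom))
    (tensorHom_comp_tensorHom := fun f₁ f₂ g₁ g₂ =>
      (𝓓.T.cmap_vcomp (A := (_, _)) (B := (_, _)) (A' := (_, _)) (B' := (_, _)) (A'' := (_, _))
        (B'' := (_, _)) (f := (_, _)) (g := (_, _)) (h := (_, _)) (f₁, f₂) (g₁, g₂)).symm)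
    (associator_naturality := fun f g h =>
      𝓓.α.hom.cell_naturality (A := (_, (_, _))) (B := (_, (_, _))) (A' := (_, (_, _)))
        (B' := (_, (_, _))) (f := (_, (_, _))) (g := (_, (_, _))) (f, (g, h)))
    (leftUnitor_naturality := fun f => by
      have := 𝓓.lam.hom.cell_naturality f
      refine Eq.trans ?_ this
      change 𝓓.T.c _ _ ≫ᵥ _ = 𝓓.T.c (𝓓.I.cmap (vid _)) _ ≫ᵥ _
      rw [𝓓.I.cmap_vid]
      rfl)
    (rightUnitor_naturality := fun f => by
      have := 𝓓.rho.hom.cell_naturality f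
      refine Eq.trans ?_ this
      change 𝓓.T.c _ _ ≫ᵥ _ = 𝓓.T.c _ (𝓓.I.cmap (vid _)) ≫ᵥ _
      rw [𝓓.I.cmap_vid]
      rfl)
    (pentagon := fun f g h k => 𝓓.pentagon₁ f.hom g.hom h.hom k.hom)
    (triangle := fun f g => 𝓓.triangle₁ f.hom g.hom)

end VMonoidal

namespace VBraiding

variable {M : Type u} [DoubleCategory.{z, w, v, u} M] {𝓜 : VMonoidal M} (Ψ : VBraiding 𝓜)

/-- The braiding on the monoidal category of objects and 1v-cells. -/
@[reducible] def braided₀ : @BraidedCategory M _ 𝓜.monoidal₀ :=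
  letI := 𝓜.monoidal₀
  { braiding := fun A B => ⟨Ψ.Φ₀ A B, Ψ.Φ.inv.app (A, B), Ψ.Φ.app_hom_inv _, Ψ.Φ.app_inv_hom _⟩
    braiding_naturality_right := fun A _ _ f =>
      Ψ.Φ.hom.app_naturality (A := (_, _)) (A' := (_, _)) (𝟙 A, f)
    braiding_naturality_left := fun f A =>
      Ψ.Φ.hom.app_naturality (A := (_, _)) (A' := (_, _)) (f, 𝟙 A)
    hexagon_forward := fun A B C => (Ψ.hexagon₀ A B C).symm
    hexagon_reverse := fun A B C => (Ψ.hexagonInv₀ A B C).symm }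

/-- The braiding on the monoidal category of 1h-cells and 2-cells. -/
@[reducible] def braided₁ : @BraidedCategory (HArrow M) _ 𝓜.monoidal₁ :=
  letI := 𝓜.monoidal₁
  { braiding := fun f g => ⟨Ψ.Φ₁ f.hom g.hom, Ψ.Φ.inv.cell (A := (_, _)) (B := (_, _))
      (f.hom, g.hom), Ψ.Φ.cell_hom_inv _, Ψ.Φ.cell_inv_hom _⟩
    braiding_naturality_right := fun f _ _ a =>
      Ψ.Φ.hom.cell_naturality (A := (_, _)) (B := (_, _)) (A' := (_, _)) (B' := (_, _))
        (f := (_, _)) (g := (_, _)) (vid f.hom, a)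
    braiding_naturality_left := fun a f =>
      Ψ.Φ.hom.cell_naturality (A := (_, _)) (B := (_, _)) (A' := (_, _)) (B' := (_, _))
        (f := (_, _)) (g := (_, _)) (a, vid f.hom)
    hexagon_forward := fun f g h => (Ψ.hexagon₁ f.hom g.hom h.hom).symm
    hexagon_reverse := fun f g h => (Ψ.hexagonInv₁ f.hom g.hom h.hom).symm }

end VBraiding

/-! ### The lax actions on these two categories. -/

namespace PDFunctor

variable {B : Type u₁} [DoubleCategory.{z₁, w₁, v₁, u₁} B] {C : Type u₂}
  [DoubleCategory.{z₂, w₂, v₂, u₂} C] {D : Type u₃} [DoubleCategory.{z₃, w₃, v₃, u₃} D]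
  (T : PDFunctor (B × C) D)

lemma v_id (X : B) (Y : C) : T.v (𝟙 X) (𝟙 Y) = 𝟙 (T.o X Y) := T.map_id (X, Y)

lemma v_comp {X X' X'' : B} {Y Y' Y'' : C} (p : X ⟶ X') (p' : X' ⟶ X'') (q : Y ⟶ Y')
    (q' : Y' ⟶ Y'') : T.v p q ≫ T.v p' q' = T.v (p ≫ p') (q ≫ q') :=
  (T.map_comp (X := (_, _)) (Y := (_, _)) (Z := (_, _)) (p, q) (p', q')).symm

lemma c_vid {X X' : B} {Y Y' : C} (f : HHom X X') (g : HHom Y Y') :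
    T.c (vid f) (vid g) = vid (T.h f g) :=
  T.cmap_vid (A := (_, _)) (B := (_, _)) (f, g)

lemma c_vcomp {X₁ X₂ X₁' X₂' X₁'' X₂'' : B} {Y₁ Y₂ Y₁' Y₂' Y₁'' Y₂'' : C} {f : HHom X₁ X₂}
    {f' : HHom X₁' X₂'} {f'' : HHom X₁'' X₂''} {g : HHom Y₁ Y₂} {g' : HHom Y₁' Y₂'}
    {g'' : HHom Y₁'' Y₂''} (a : Cell f f') (a' : Cell f' f'') (b : Cell g g')
    (b' : Cell g' g'') : T.c a b ≫ᵥ T.c a' b' = T.c (a ≫ᵥ a') (b ≫ᵥ b') :=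
  (T.cmap_vcomp (A := (_, _)) (B := (_, _)) (A' := (_, _)) (B' := (_, _)) (A'' := (_, _))
    (B'' := (_, _)) (f := (_, _)) (g := (_, _)) (h := (_, _)) (a, b) (a', b')).symm

end PDFunctor

namespace LaxAction

variable {M : Type u₁} [DoubleCategory.{z₁, w₁, v₁, u₁} M] {𝓜 : VMonoidal M}
  {D : Type u₂} [DoubleCategory.{z₂, w₂, v₂, u₂} D] (𝓐 : LaxAction 𝓜 D)

/-- The lax action of the category of objects and 1v-cells. -/
@[reducible] def act₀ : @CatLaxAction M _ 𝓜.monoidal₀ D _ :=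
  letI := 𝓜.monoidal₀
  { ob := 𝓐.F.o
    wl := fun P _ _ f => 𝓐.F.v (𝟙 P) f
    wr := fun p A => 𝓐.F.v p (𝟙 A)
    wl_id := fun P A => 𝓐.F.v_id P A
    wl_comp := fun P _ _ _ f g => by rw [𝓐.F.v_comp, Category.comp_id]
    wr_id := fun P A => 𝓐.F.v_id P A
    wr_comp := fun p q A => by rw [𝓐.F.v_comp, Category.comp_id]
    exch := fun p _ _ f => by
      rw [𝓐.F.v_comp, 𝓐.F.v_comp, Category.comp_id, Category.comp_id, Category.id_comp,
        Category.id_comp]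
    β := 𝓐.β₀
    β_wl := fun P Q _ _ f => by
      refine (𝓐.β.app_naturality (A := (_, (_, _))) (A' := (_, (_, _))) (𝟙 P, (𝟙 Q, f))).trans ?_
      -- Naturality of `β` produces the tensor of two identities where whiskering has a single one.
      change _ ≫ 𝓐.F.v (𝓜.T.v (𝟙 P) (𝟙 Q)) f = _
      rw [𝓜.T.v_id]
      rfl
    β_mid := fun P _ _ q A =>
      𝓐.β.app_naturality (A := (_, (_, _))) (A' := (_, (_, _))) (𝟙 P, (q, 𝟙 A))
    β_wr := fun p Q A => by
      refine Eq.trans ?_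
        (𝓐.β.app_naturality (A := (_, (_, _))) (A' := (_, (_, _))) (p, (𝟙 Q, 𝟙 A)))
      change _ = 𝓐.F.v p (𝓐.F.v (𝟙 Q) (𝟙 A)) ≫ _
      rw [𝓐.F.v_id]
    ν := 𝓐.ν₀
    ν_nat := fun f => by
      refine (𝓐.ν.app_naturality f).trans ?_
      change _ ≫ 𝓐.F.v (𝓜.I.map (𝟙 _)) f = _
      rw [𝓜.I.map_id]
      rfl
    pentagon := 𝓐.pentagon₀
    unitL := 𝓐.unitLeft₀
    unitR := 𝓐.unitRight₀ }

/-- The lax action of the category of 1h-cells and 2-cells. -/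
@[reducible] def act₁ : @CatLaxAction (HArrow M) _ 𝓜.monoidal₁ (HArrow D) _ :=
  letI := 𝓜.monoidal₁
  { ob := fun p f => ⟨𝓐.F.h p.hom f.hom⟩
    wl := fun p _ _ a => 𝓐.F.c (vid p.hom) a
    wr := fun a f => 𝓐.F.c a (vid f.hom)
    wl_id := fun p f => 𝓐.F.c_vid p.hom f.hom
    wl_comp := fun p _ _ _ a b => by
      refine Eq.trans ?_ (𝓐.F.c_vcomp (vid p.hom) (vid p.hom) a b).symm
      rw [vid_vcomp]
      rfl
    wr_id := fun p f => 𝓐.F.c_vid p.hom f.hom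
    wr_comp := fun a b f => by
      refine Eq.trans ?_ (𝓐.F.c_vcomp a b (vid f.hom) (vid f.hom)).symm
      rw [vid_vcomp]
      rfl
    exch := fun a _ _ b => by
      refine (𝓐.F.c_vcomp (vid _) a b (vid _)).trans
        (Eq.trans ?_ (𝓐.F.c_vcomp a (vid _) (vid _) b).symm)
      rw [vid_vcomp, vid_vcomp, vcomp_vid, vcomp_vid]
    β := fun p q f => 𝓐.β₁ p.hom q.hom f.hom
    β_wl := fun p q _ _ a => by
      refine (𝓐.β.cell_naturality (A := (_, (_, _))) (B := (_, (_, _))) (A' := (_, (_, _)))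
        (B' := (_, (_, _))) (f := (_, (_, _))) (g := (_, (_, _)))
        (vid p.hom, (vid q.hom, a))).trans ?_
      change _ ≫ᵥ 𝓐.F.c (𝓜.T.c (vid p.hom) (vid q.hom)) a = _
      rw [𝓜.T.c_vid]
      rfl
    β_mid := fun p _ _ b f =>
      𝓐.β.cell_naturality (A := (_, (_, _))) (B := (_, (_, _))) (A' := (_, (_, _)))
        (B' := (_, (_, _))) (f := (_, (_, _))) (g := (_, (_, _))) (vid p.hom, (b, vid f.hom))
    β_wr := fun a q f => by
      refine Eq.trans ?_
        (𝓐.β.cell_naturality (A := (_, (_, _))) (B := (_, (_, _))) (A' := (_, (_, _)))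
        (B' := (_, (_, _))) (f := (_, (_, _))) (g := (_, (_, _))) (a, (vid q.hom, vid f.hom)))
      change _ = 𝓐.F.c a (𝓐.F.c (vid q.hom) (vid f.hom)) ≫ᵥ _
      rw [𝓐.F.c_vid]
      rfl
    ν := fun f => 𝓐.ν₁ f.hom
    ν_nat := fun a => by
      refine (𝓐.ν.cell_naturality a).trans ?_
      change _ ≫ᵥ 𝓐.F.c (𝓜.I.cmap (vid _)) a = _
      rw [𝓜.I.cmap_vid]
      rfl
    pentagon := fun p q r f => 𝓐.pentagon₁ p.hom q.hom r.hom f.hom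
    unitL := fun p f => 𝓐.unitLeft₁ p.hom f.hom
    unitR := fun p f => 𝓐.unitRight₁ p.hom f.hom }

end LaxAction

/-! ### Equalities between composites of pseudodouble functors. -/

namespace PDFunctor

section

variable {C : Type u₁} [DoubleCategory.{z₁, w₁, v₁, u₁} C] {D : Type u₂}
  [DoubleCategory.{z₂, w₂, v₂, u₂} D]

/-- The heterogeneous equalities account for the dependence of later fields on earlier ones. In the
applications the values on objects, 1v-cells, 1h-cells and 2-cells agree definitionally, and only
the horizontal comparison cells need an argument. -/
lemma ext_of_heq {F G : PDFunctor C D} (h₁ : F.toFunctor = G.toFunctor)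
    (h₂ : @PDFunctor.hmap _ _ _ _ F ≍ @PDFunctor.hmap _ _ _ _ G)
    (h₃ : @PDFunctor.cmap _ _ _ _ F ≍ @PDFunctor.cmap _ _ _ _ G)
    (h₄ : @PDFunctor.comp _ _ _ _ F ≍ @PDFunctor.comp _ _ _ _ G)
    (h₅ : @PDFunctor.compInv _ _ _ _ F ≍ @PDFunctor.compInv _ _ _ _ G)
    (h₆ : F.unit ≍ G.unit) (h₇ : F.unitInv ≍ G.unitInv) : F = G := by
  cases F
  cases G
  cases h₁
  cases h₂
  cases h₃
  cases h₄
  cases h₅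
  cases h₆
  cases h₇
  rfl

end

variable {A : Type u} [DoubleCategory.{z, w, v, u} A] {B : Type u₁}
  [DoubleCategory.{z₁, w₁, v₁, u₁} B] {C : Type u₂} [DoubleCategory.{z₂, w₂, v₂, u₂} C]
  {D : Type u₃} [DoubleCategory.{z₃, w₃, v₃, u₃} D]

/-- The comparison cells of the two bracketings agree because `H` preserves vertical composition and
vertical composition is associative. -/
lemma compF_compF (F : PDFunctor A B) (G : PDFunctor B C) (H : PDFunctor C D) :
    F.compF (G.compF H) = (F.compF G).compF H := by
  refine ext_of_heq rfl HEq.rfl HEq.rfl (heq_of_eq ?_) (heq_of_eq ?_) (heq_of_eq ?_)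
    (heq_of_eq ?_)
  · funext _ _ _ f g
    exact (vcomp_assoc _ _ _).trans (congrArg (_ ≫ᵥ ·) (H.cmap_vcomp _ _).symm)
  · funext _ _ _ f g
    exact ((vcomp_assoc _ _ _).symm.trans (congrArg (· ≫ᵥ _) (H.cmap_vcomp _ _).symm))
  · funext X
    exact (vcomp_assoc _ _ _).trans (congrArg (_ ≫ᵥ ·) (H.cmap_vcomp _ _).symm)
  · funext X
    exact ((vcomp_assoc _ _ _).symm.trans (congrArg (· ≫ᵥ _) (H.cmap_vcomp _ _).symm))

lemma compF_pair (H : PDFunctor A B) (F : PDFunctor B C) (G : PDFunctor B D) :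
    H.compF (pair F G) = pair (H.compF F) (H.compF G) := rfl

lemma compF_idF (F : PDFunctor A B) : F.compF (idF B) = F := by
  refine ext_of_heq rfl HEq.rfl HEq.rfl (heq_of_eq ?_) (heq_of_eq ?_) (heq_of_eq ?_)
    (heq_of_eq ?_)
  · funext _ _ _ f g
    exact vid_vcomp _
  · funext _ _ _ f g
    exact vcomp_vid _
  · funext X
    exact vid_vcomp _
  · funext X
    exact vcomp_vid _

lemma pair_compF_fstF (F : PDFunctor A B) (G : PDFunctor A C) :
    (pair F G).compF (fstF B C) = F := by
  refine ext_of_heq rfl HEq.rfl HEq.rfl (heq_of_eq ?_) (heq_of_eq ?_) (heq_of_eq ?_)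
    (heq_of_eq ?_)
  · funext _ _ _ f g
    exact vid_vcomp _
  · funext _ _ _ f g
    exact vcomp_vid _
  · funext X
    exact vid_vcomp _
  · funext X
    exact vcomp_vid _

lemma pair_compF_sndF (F : PDFunctor A B) (G : PDFunctor A C) :
    (pair F G).compF (sndF B C) = G := by
  refine ext_of_heq rfl HEq.rfl HEq.rfl (heq_of_eq ?_) (heq_of_eq ?_) (heq_of_eq ?_)
    (heq_of_eq ?_)
  · funext _ _ _ f g
    exact vid_vcomp _
  · funext _ _ _ f g
    exact vcomp_vid _
  · funext X
    exact vid_vcomp _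
  · funext X
    exact vcomp_vid _

lemma pair_fstF_sndF : pair (fstF B C) (sndF B C) = idF (B × C) := rfl

/-- Identifies $F(X_1,X_2)$, written with projections, with the functor applied to the pair $X$; the
source of $F^2$ has the second form. -/
lemma pair_compF_fstF_compF_sndF (F : PDFunctor A (B × C)) :
    pair (F.compF (fstF B C)) (F.compF (sndF B C)) = F := by
  rw [← compF_pair, pair_fstF_sndF, compF_idF]

lemma compF_toPoint (F : PDFunctor A B) : F.compF (toPoint B) = toPoint A := rfl

lemma toPoint_dPoint : toPoint DPoint = idF DPoint := rfl

lemma idF_compF (F : PDFunctor A B) : (idF A).compF F = F := by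
  refine ext_of_heq rfl HEq.rfl HEq.rfl (heq_of_eq ?_) (heq_of_eq ?_) (heq_of_eq ?_)
    (heq_of_eq ?_)
  · funext _ _ _ f g
    exact (congrArg (_ ≫ᵥ ·) (F.cmap_vid _)).trans (vcomp_vid _)
  · funext _ _ _ f g
    exact (congrArg (· ≫ᵥ _) (F.cmap_vid _)).trans (vid_vcomp _)
  · funext X
    exact (congrArg (_ ≫ᵥ ·) (F.cmap_vid _)).trans (vcomp_vid _)
  · funext X
    exact (congrArg (· ≫ᵥ _) (F.cmap_vid _)).trans (vid_vcomp _)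

end PDFunctor

/-! ### Whiskering, composing and transporting vertical strict transformations. -/

namespace VTrans

variable {B : Type u₁} [DoubleCategory.{z₁, w₁, v₁, u₁} B] {C : Type u₂}
  [DoubleCategory.{z₂, w₂, v₂, u₂} C] {D : Type u₃} [DoubleCategory.{z₃, w₃, v₃, u₃} D]

/-- The identity vertical strict transformation. -/
def idT (F : PDFunctor C D) : VTrans F F where
  app A := 𝟙 _
  cell f := vid _
  left_cell _ := left_vid _
  right_cell _ := right_vid _
  app_naturality _ := by rw [Category.comp_id, Category.id_comp]
  cell_naturality _ := by rw [vcomp_vid, vid_vcomp]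
  cell_comp _ _ _ := by rw [hcompCell_vid, vcomp_vid, vid_vcomp]
  cell_unit _ := by rw [hidCell_id, vcomp_vid, vid_vcomp]

/-- The vertical composite of vertical strict transformations. -/
def compT {F G H : PDFunctor C D} (σ : VTrans F G) (τ : VTrans G H) : VTrans F H where
  app A := σ.app A ≫ τ.app A
  cell f := σ.cell f ≫ᵥ τ.cell f
  left_cell _ := by rw [left_vcomp, σ.left_cell, τ.left_cell]
  right_cell _ := by rw [right_vcomp, σ.right_cell, τ.right_cell]
  app_naturality p := by
    rw [← Category.assoc, σ.app_naturality, Category.assoc, τ.app_naturality, Category.assoc]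
  cell_naturality a := by
    rw [← vcomp_assoc, σ.cell_naturality, vcomp_assoc, τ.cell_naturality, vcomp_assoc]
  cell_comp f g e := by
    have e₁ : right (σ.cell f) = left (σ.cell g) := by rw [σ.right_cell, σ.left_cell]
    have e₂ : right (τ.cell f) = left (τ.cell g) := by rw [τ.right_cell, τ.left_cell]
    rw [interchange _ _ _ _ e₁ e₂, vcomp_assoc, τ.cell_comp, ← vcomp_assoc, σ.cell_comp,
      vcomp_assoc]
  cell_unit A := by
    rw [hidCell_comp, vcomp_assoc, τ.cell_unit, ← vcomp_assoc, σ.cell_unit, vcomp_assoc]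

/-- Precomposition of a vertical strict transformation with a pseudodouble functor. -/
def pre (H : PDFunctor B C) {F G : PDFunctor C D} (σ : VTrans F G) :
    VTrans (H.compF F) (H.compF G) where
  app A := σ.app (H.obj A)
  cell f := σ.cell (H.hmap f)
  left_cell _ := σ.left_cell _
  right_cell _ := σ.right_cell _
  app_naturality p := σ.app_naturality (H.map p)
  cell_naturality a := σ.cell_naturality (H.cmap a)
  cell_comp f g e := by
    have e₁ : right (σ.cell (H.hmap f)) = left (σ.cell (H.hmap g)) := e
    -- The comparison cell of a composite functor contains the image of `H.comp f g`, so naturality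
    -- of `σ` at that 2-cell is needed besides its own compatibility.
    have k : hcompCell (σ.cell (H.hmap f)) (σ.cell (H.hmap g)) e₁ ≫ᵥ
        (G.comp (H.hmap f) (H.hmap g) ≫ᵥ G.cmap (H.comp f g)) =
        (F.comp (H.hmap f) (H.hmap g) ≫ᵥ F.cmap (H.comp f g)) ≫ᵥ
          σ.cell (H.hmap (hcomp f g)) := by
      rw [← vcomp_assoc, σ.cell_comp, vcomp_assoc, vcomp_assoc, σ.cell_naturality]
    exact k
  cell_unit A := by
    have k : hidCell (σ.app (H.obj A)) ≫ᵥ (G.unit (H.obj A) ≫ᵥ G.cmap (H.unit A)) =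
        (F.unit (H.obj A) ≫ᵥ F.cmap (H.unit A)) ≫ᵥ σ.cell (H.hmap (hid A)) := by
      rw [← vcomp_assoc, σ.cell_unit, vcomp_assoc, vcomp_assoc, σ.cell_naturality]
    exact k

/-- Postcomposition of a vertical strict transformation with a pseudodouble functor. -/
def post {F G : PDFunctor B C} (σ : VTrans F G) (K : PDFunctor C D) :
    VTrans (F.compF K) (G.compF K) where
  app A := K.map (σ.app A)
  cell f := K.cmap (σ.cell f)
  left_cell f := (K.left_cmap _).trans (congrArg K.map (σ.left_cell f))
  right_cell f := (K.right_cmap _).trans (congrArg K.map (σ.right_cell f))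
  app_naturality p := by
    change K.map _ ≫ _ = _ ≫ K.map _
    rw [← K.map_comp, σ.app_naturality, K.map_comp]
  cell_naturality a := by
    change K.cmap _ ≫ᵥ _ = _ ≫ᵥ K.cmap _
    rw [← K.cmap_vcomp, σ.cell_naturality, K.cmap_vcomp]
  cell_comp f g e := by
    have e₁ : right (σ.cell f) = left (σ.cell g) := by rw [σ.right_cell, σ.left_cell]
    have e₂ : right (K.cmap (σ.cell f)) = left (K.cmap (σ.cell g)) := e
    -- Naturality of the comparison cells of `K` reduces this to the image under `K` of the
    -- compatibility of `σ`.
    have k : hcompCell (K.cmap (σ.cell f)) (K.cmap (σ.cell g)) e₂ ≫ᵥ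
        (K.comp (G.hmap f) (G.hmap g) ≫ᵥ K.cmap (G.comp f g)) =
        (K.comp (F.hmap f) (F.hmap g) ≫ᵥ K.cmap (F.comp f g)) ≫ᵥ
          K.cmap (σ.cell (hcomp f g)) := by
      rw [← vcomp_assoc, K.comp_naturality _ _ e₁, vcomp_assoc, ← K.cmap_vcomp, σ.cell_comp,
        K.cmap_vcomp, vcomp_assoc]
    exact k
  cell_unit A := by
    have k : hidCell (K.map (σ.app A)) ≫ᵥ (K.unit (G.obj A) ≫ᵥ K.cmap (G.unit A)) =
        (K.unit (F.obj A) ≫ᵥ K.cmap (F.unit A)) ≫ᵥ K.cmap (σ.cell (hid A)) := by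
      rw [← vcomp_assoc, K.unit_naturality, vcomp_assoc, ← K.cmap_vcomp, σ.cell_unit,
        K.cmap_vcomp, vcomp_assoc]
    exact k

/-- The vertical strict transformation between functors into a product with given components. -/
def pairT {F F' : PDFunctor B C} {G G' : PDFunctor B D} (σ : VTrans F F') (τ : VTrans G G') :
    VTrans (pair F G) (pair F' G') where
  app A := (σ.app A, τ.app A)
  cell f := (σ.cell f, τ.cell f)
  left_cell _ := Prod.ext (σ.left_cell _) (τ.left_cell _)
  right_cell _ := Prod.ext (σ.right_cell _) (τ.right_cell _)
  app_naturality _ := Prod.ext (σ.app_naturality _) (τ.app_naturality _)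
  cell_naturality _ := Prod.ext (σ.cell_naturality _) (τ.cell_naturality _)
  cell_comp _ _ _ := Prod.ext (σ.cell_comp _ _ _) (τ.cell_comp _ _ _)
  cell_unit _ := Prod.ext (σ.cell_unit _) (τ.cell_unit _)

/-- The action of a functor of two variables on vertical strict transformations. -/
abbrev apT {E : Type u₄} [DoubleCategory.{z₄, w₄, v₄, u₄} E] (T : PDFunctor (C × D) E)
    {F F' : PDFunctor B C} {G G' : PDFunctor B D} (σ : VTrans F F') (τ : VTrans G G') :
    VTrans (ap T F G) (ap T F' G') :=
  (pairT σ τ).post T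

/-- Transport of a vertical strict transformation along equalities of its source and target,
with prescribed components. -/
def copy {F F' G G' : PDFunctor C D} (σ : VTrans F G) (hF : F = F') (hG : G = G')
    (app : ∀ A : C, F'.obj A ⟶ G'.obj A)
    (cell : ∀ {A B : C} (f : HHom A B), Cell (F'.hmap f) (G'.hmap f))
    (happ : app ≍ σ.app) (hcell : @cell ≍ @VTrans.cell _ _ _ _ _ _ σ) : VTrans F' G' where
  app := app
  cell := cell
  left_cell f := by subst hF hG; cases happ; cases hcell; exact σ.left_cell f
  right_cell f := by subst hF hG; cases happ; cases hcell; exact σ.right_cell f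
  app_naturality p := by subst hF hG; cases happ; exact σ.app_naturality p
  cell_naturality a := by subst hF hG; cases hcell; exact σ.cell_naturality a
  cell_comp f g e := by subst hF hG; cases hcell; exact σ.cell_comp f g e
  cell_unit A := by subst hF hG; cases happ; cases hcell; exact σ.cell_unit A

end VTrans

/-! ### Structure transformations evaluated at functors, and the two constructions of data. -/

section Reindexing

variable {M : Type u₁} [DoubleCategory.{z₁, w₁, v₁, u₁} M] {𝓜 : VMonoidal M} {D : Type u₂}
  [DoubleCategory.{z₂, w₂, v₂, u₂} D] {𝓓 : VMonoidal D} {𝓐 : LaxAction 𝓜 D}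
  {B : Type u} [DoubleCategory.{z, w, v, u} B]

/-- The left unitor at a functor. -/
def VMonoidal.lamAt (𝓜 : VMonoidal M) (P : PDFunctor B M) :
    VTrans (ap 𝓜.T (constF B 𝓜.I) P) P :=
  (𝓜.lam.hom.pre P).copy
    (by simp only [compF_compF, compF_pair, compF_idF, compF_toPoint]) (compF_idF P)
    (fun X => 𝓜.lam₀ (P.obj X)) (fun f => 𝓜.lam₁ (P.hmap f)) HEq.rfl HEq.rfl

/-- The right unitor at a functor. -/
def VMonoidal.rhoAt (𝓜 : VMonoidal M) (P : PDFunctor B M) :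
    VTrans (ap 𝓜.T P (constF B 𝓜.I)) P :=
  (𝓜.rho.hom.pre P).copy
    (by simp only [compF_compF, compF_pair, compF_idF, compF_toPoint]) (compF_idF P)
    (fun X => 𝓜.rho₀ (P.obj X)) (fun f => 𝓜.rho₁ (P.hmap f)) HEq.rfl HEq.rfl

/-- The transformation `β` at functors. -/
def LaxAction.βAt (𝓐 : LaxAction 𝓜 D) (P Q : PDFunctor B M) (X : PDFunctor B D) :
    VTrans (ap 𝓐.F P (ap 𝓐.F Q X)) (ap 𝓐.F (ap 𝓜.T P Q) X) :=
  (𝓐.β.pre (pair P (pair Q X))).copy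
    (by simp only [compF_compF, compF_pair, pair_compF_fstF, pair_compF_sndF])
    (by simp only [compF_compF, compF_pair, pair_compF_fstF, pair_compF_sndF])
    (fun _ => 𝓐.β₀ _ _ _) (fun _ => 𝓐.β₁ _ _ _) HEq.rfl HEq.rfl

/-- The transformation `ν` at a functor. -/
def LaxAction.νAt (𝓐 : LaxAction 𝓜 D) (X : PDFunctor B D) :
    VTrans X (ap 𝓐.F (constF B 𝓜.I) X) :=
  (𝓐.ν.pre X).copy (compF_idF X)
    (by simp only [compF_compF, compF_pair, compF_idF, compF_toPoint])
    (fun _ => 𝓐.ν₀ _) (fun _ => 𝓐.ν₁ _) HEq.rfl HEq.rfl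

/-- The transformation `F²` at functors. -/
def LaxMonoidalData.F2At (L : LaxMonoidalData 𝓐 𝓓) (P : PDFunctor B M) (X : PDFunctor B D)
    (Q : PDFunctor B M) (Y : PDFunctor B D) :
    VTrans (ap 𝓓.T (ap 𝓐.F P X) (ap 𝓐.F Q Y)) (ap 𝓐.F (ap 𝓜.T P Q) (ap 𝓓.T X Y)) :=
  (L.F2.pre (pair (pair P X) (pair Q Y))).copy
    (by simp only [compF_compF, compF_pair, pair_compF_fstF, pair_compF_sndF])
    (by simp only [compF_compF, compF_pair, pair_compF_fstF, pair_compF_sndF])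
    (fun _ => L.m₀ _ _ _ _) (fun _ => L.m₁ _ _ _ _) HEq.rfl HEq.rfl

/-- The left strength at functors. -/
def LeftStrengthData.tAt (S : LeftStrengthData 𝓐 𝓓) (P : PDFunctor B M) (X Y : PDFunctor B D) :
    VTrans (ap 𝓓.T X (ap 𝓐.F P Y)) (ap 𝓐.F P (ap 𝓓.T X Y)) :=
  (S.t.pre (pair P (pair X Y))).copy
    (by simp only [compF_compF, compF_pair, pair_compF_fstF, pair_compF_sndF])
    (by simp only [compF_compF, compF_pair, pair_compF_fstF, pair_compF_sndF])
    (fun _ => S.t₀ _ _ _) (fun _ => S.t₁ _ _ _) HEq.rfl HEq.rfl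

/-- The right strength at functors. -/
def RightStrengthData.sAt (S : RightStrengthData 𝓐 𝓓) (P : PDFunctor B M)
    (X Y : PDFunctor B D) :
    VTrans (ap 𝓓.T (ap 𝓐.F P X) Y) (ap 𝓐.F P (ap 𝓓.T X Y)) :=
  (S.s.pre (pair P (pair X Y))).copy
    (by simp only [compF_compF, compF_pair, pair_compF_fstF, pair_compF_sndF])
    (by simp only [compF_compF, compF_pair, pair_compF_fstF, pair_compF_sndF])
    (fun _ => S.s₀ _ _ _) (fun _ => S.s₁ _ _ _) HEq.rfl HEq.rfl

/-- The left strength data obtained from a lax monoidal structure. -/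
def LaxMonoidalData.leftStrengthData (L : LaxMonoidalData 𝓐 𝓓) : LeftStrengthData 𝓐 𝓓 where
  -- The formula of `leftStrengthOf` read for transformations: horizontal compatibility is
  -- inherited, and the components unfold to the one-dimensional formula in both categories.
  t := (VTrans.apT 𝓓.T (𝓐.νAt _) (.idT _)).compT
    ((L.F2At _ _ _ _).compT (VTrans.apT 𝓐.F (𝓜.lamAt _) (.idT _)))

/-- The right strength data obtained from a lax monoidal structure. -/
def LaxMonoidalData.rightStrengthData (L : LaxMonoidalData 𝓐 𝓓) : RightStrengthData 𝓐 𝓓 where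
  s := (VTrans.apT 𝓓.T (.idT _) (𝓐.νAt _)).compT
    ((L.F2At _ _ _ _).compT (VTrans.apT 𝓐.F (𝓜.rhoAt _) (.idT _)))

/-- The lax monoidal data obtained from a left and a right strength. -/
def laxMonoidalDataOf (t : LeftStrengthData 𝓐 𝓓) (s : RightStrengthData 𝓐 𝓓) :
    LaxMonoidalData 𝓐 𝓓 where
  -- The formula of `mulOf`. The outer `copy` is needed because the source of $F^2$ applies the
  -- action to a projection of $(M\times D)^2$, whereas `sAt` expects a pair of projections.
  F2 := VTrans.copy ((s.sAt ((fstF (M × D) (M × D)).compF (fstF M D))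
      ((fstF (M × D) (M × D)).compF (sndF M D)) (ap 𝓐.F
        ((sndF (M × D) (M × D)).compF (fstF M D)) ((sndF (M × D) (M × D)).compF (sndF M D)))).compT
      ((VTrans.apT 𝓐.F (.idT _) (t.tAt _ _ _)).compT (𝓐.βAt _ _ _)))
    (by simp only [ap, pair_compF_fstF_compF_sndF]) rfl
    (fun X => s.s₀ X.1.1 X.1.2 (𝓐.F.obj X.2) ≫ 𝓐.F.v (𝟙 _) (t.t₀ X.2.1 X.1.2 X.2.2) ≫
      𝓐.β₀ X.1.1 X.2.1 _)
    (fun f => s.s₁ f.1.1 f.1.2 (𝓐.F.hmap f.2) ≫ᵥ 𝓐.F.c (vid _) (t.t₁ f.2.1 f.1.2 f.2.2) ≫ᵥ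
      𝓐.β₁ f.1.1 f.2.1 _)
    HEq.rfl HEq.rfl
  -- The choice $\iota=\nu_I$; over the terminal double category the constant functor at the unit of
  -- $M$ is the unit functor itself.
  F0 := (𝓐.νAt 𝓓.I).copy rfl (by simp only [constF, toPoint_dPoint, idF_compF])
    (fun X => 𝓐.ν₀ (𝓓.I.obj X)) (fun f => 𝓐.ν₁ (𝓓.I.hmap f)) HEq.rfl HEq.rfl

end Reindexing

/-! ### Reading the laws of a lax monoidal structure in the two categories. -/

namespace VBraiding

variable {M : Type u} [DoubleCategory.{z, w, v, u} M] {𝓜 : VMonoidal M} (Ψ : VBraiding 𝓜)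

open MonoidalCategory in
-- The two interchangers differ only in whether a composite is whiskered as a whole or factor by
-- factor.
lemma mid₀_eq (P Q R S : M) :
    Ψ.mid₀ P Q R S = @MonoidalCategory.tensorμ M _ 𝓜.monoidal₀ Ψ.braided₀ P Q R S := by
  let _ := 𝓜.monoidal₀
  let _ := Ψ.braided₀
  have e : Ψ.mid₀ P Q R S = (α_ P Q (R ⊗ S)).hom ≫
      (P ◁ ((α_ Q R S).inv ≫ (β_ Q R).hom ▷ S ≫ (α_ R Q S).hom)) ≫ (α_ P R (Q ⊗ S)).inv := rfl
  rw [e]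
  simp only [MonoidalCategory.tensorμ, MonoidalCategory.whiskerLeft_comp, Category.assoc]

open MonoidalCategory in
lemma mid₁_eq (p q r s : HArrow M) :
    Ψ.mid₁ p.hom q.hom r.hom s.hom =
      @MonoidalCategory.tensorμ (HArrow M) _ 𝓜.monoidal₁ Ψ.braided₁ p q r s := by
  let _ := 𝓜.monoidal₁
  let _ := Ψ.braided₁
  have e : Ψ.mid₁ p.hom q.hom r.hom s.hom = (α_ p q (r ⊗ s)).hom ≫
      (p ◁ ((α_ q r s).inv ≫ (β_ q r).hom ▷ s ≫ (α_ r q s).hom)) ≫ (α_ p r (q ⊗ s)).inv := rfl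
  rw [e]
  simp only [MonoidalCategory.tensorμ, MonoidalCategory.whiskerLeft_comp, Category.assoc]

end VBraiding

section

variable {M : Type u₁} [DoubleCategory.{z₁, w₁, v₁, u₁} M] {𝓜 : VMonoidal M} {D : Type u₂}
  [DoubleCategory.{z₂, w₂, v₂, u₂} D] {𝓓 : VMonoidal D} {𝓐 : LaxAction 𝓜 D}

lemma LaxMonoidalData.m₀_naturality (L : LaxMonoidalData 𝓐 𝓓) {P P' Q Q' : M} {A A' B B' : D}
    (p : P ⟶ P') (f : A ⟶ A') (q : Q ⟶ Q') (g : B ⟶ B') :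
    𝓓.T.v (𝓐.F.v p f) (𝓐.F.v q g) ≫ L.m₀ P' A' Q' B' =
      L.m₀ P A Q B ≫ 𝓐.F.v (𝓜.T.v p q) (𝓓.T.v f g) :=
  L.F2.app_naturality (A := ((_, _), (_, _))) (A' := ((_, _), (_, _))) ((p, f), (q, g))

lemma LaxMonoidalData.m₁_naturality (L : LaxMonoidalData 𝓐 𝓓) {P₁ P₂ P₁' P₂' Q₁ Q₂ Q₁' Q₂' : M}
    {A₁ A₂ A₁' A₂' B₁ B₂ B₁' B₂' : D} {p : HHom P₁ P₂} {p' : HHom P₁' P₂'} {q : HHom Q₁ Q₂}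
    {q' : HHom Q₁' Q₂'} {f : HHom A₁ A₂} {f' : HHom A₁' A₂'} {g : HHom B₁ B₂} {g' : HHom B₁' B₂'}
    (a : Cell p p') (b : Cell f f') (c : Cell q q') (d : Cell g g') :
    𝓓.T.c (𝓐.F.c a b) (𝓐.F.c c d) ≫ᵥ L.m₁ p' f' q' g' =
      L.m₁ p f q g ≫ᵥ 𝓐.F.c (𝓜.T.c a c) (𝓓.T.c b d) :=
  L.F2.cell_naturality (A := ((_, _), (_, _))) (B := ((_, _), (_, _))) (A' := ((_, _), (_, _)))
    (B' := ((_, _), (_, _))) (f := ((_, _), (_, _))) (g := ((_, _), (_, _))) ((a, b), (c, d))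

lemma LeftStrengthData.t₀_naturality (S : LeftStrengthData 𝓐 𝓓) {P P' : M} {A A' B B' : D}
    (p : P ⟶ P') (f : A ⟶ A') (g : B ⟶ B') :
    𝓓.T.v f (𝓐.F.v p g) ≫ S.t₀ P' A' B' = S.t₀ P A B ≫ 𝓐.F.v p (𝓓.T.v f g) :=
  S.t.app_naturality (A := (_, (_, _))) (A' := (_, (_, _))) (p, (f, g))

lemma LeftStrengthData.t₁_naturality (S : LeftStrengthData 𝓐 𝓓) {P₁ P₂ P₁' P₂' : M}
    {A₁ A₂ A₁' A₂' B₁ B₂ B₁' B₂' : D} {p : HHom P₁ P₂} {p' : HHom P₁' P₂'} {f : HHom A₁ A₂}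
    {f' : HHom A₁' A₂'} {g : HHom B₁ B₂} {g' : HHom B₁' B₂'}
    (a : Cell p p') (b : Cell f f') (c : Cell g g') :
    𝓓.T.c b (𝓐.F.c a c) ≫ᵥ S.t₁ p' f' g' =
      S.t₁ p f g ≫ᵥ 𝓐.F.c a (𝓓.T.c b c) :=
  S.t.cell_naturality (A := (_, (_, _))) (B := (_, (_, _))) (A' := (_, (_, _)))
    (B' := (_, (_, _))) (f := (_, (_, _))) (g := (_, (_, _))) (a, (b, c))

lemma RightStrengthData.s₀_naturality (S : RightStrengthData 𝓐 𝓓) {P P' : M} {A A' B B' : D}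
    (p : P ⟶ P') (f : A ⟶ A') (g : B ⟶ B') :
    𝓓.T.v (𝓐.F.v p f) g ≫ S.s₀ P' A' B' = S.s₀ P A B ≫ 𝓐.F.v p (𝓓.T.v f g) :=
  S.s.app_naturality (A := (_, (_, _))) (A' := (_, (_, _))) (p, (f, g))

lemma RightStrengthData.s₁_naturality (S : RightStrengthData 𝓐 𝓓) {P₁ P₂ P₁' P₂' : M}
    {A₁ A₂ A₁' A₂' B₁ B₂ B₁' B₂' : D} {p : HHom P₁ P₂} {p' : HHom P₁' P₂'} {f : HHom A₁ A₂}
    {f' : HHom A₁' A₂'} {g : HHom B₁ B₂} {g' : HHom B₁' B₂'}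
    (a : Cell p p') (b : Cell f f') (c : Cell g g') :
    𝓓.T.c (𝓐.F.c a b) c ≫ᵥ S.s₁ p' f' g' =
      S.s₁ p f g ≫ᵥ 𝓐.F.c a (𝓓.T.c b c) :=
  S.s.cell_naturality (A := (_, (_, _))) (B := (_, (_, _))) (A' := (_, (_, _)))
    (B' := (_, (_, _))) (f := (_, (_, _))) (g := (_, (_, _))) (a, (b, c))

namespace LaxMonoidal

/-- The one-dimensional laws have `ν` at the unit in place of `ι`, which is why the $\nu^0$ cocycle
is used in the unit laws. Joint naturality is split into one variable at a time by inserting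
identities. -/
lemma isMonoidal₀ {L : LaxMonoidal 𝓐 𝓓} {Ψ : VBraiding 𝓜} (hL : L.HasTrivialCocycles Ψ) :
    @CatLaxAction.IsMonoidal M _ 𝓜.monoidal₀ Ψ.braided₀ D _ 𝓓.monoidal₀ 𝓐.act₀ L.m₀ :=
  let _ := 𝓜.monoidal₀
  let _ := Ψ.braided₀
  let _ := 𝓓.monoidal₀
  { nat₁ := fun p A Q B => by
      have k := L.m₀_naturality p (𝟙 A) (𝟙 Q) (𝟙 B)
      simp only [v_id] at k
      exact k
    nat₂ := fun P _ _ f Q B => by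
      have k := L.m₀_naturality (𝟙 P) f (𝟙 Q) (𝟙 B)
      simp only [v_id] at k
      exact k
    nat₃ := fun P A _ _ q B => by
      have k := L.m₀_naturality (𝟙 P) (𝟙 A) q (𝟙 B)
      simp only [v_id] at k
      exact k
    nat₄ := fun P A Q _ _ g => by
      have k := L.m₀_naturality (𝟙 P) (𝟙 A) (𝟙 Q) g
      simp only [v_id] at k
      exact k
    assoc := fun P A Q B R C => by
      refine Eq.trans ?_ (L.assoc₀ P A Q B R C)
      -- Acting by a pair of associators at once equals acting first by the one in $M$ and then by
      -- the one in $D$.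
      refine congrArg (_ ≫ ·) (congrArg (_ ≫ ·) ?_)
      refine (𝓐.F.v_comp _ _ _ _).trans ?_
      rw [Category.id_comp, Category.comp_id]
      rfl
    unitR := fun P A => by
      refine Eq.trans ?_ (L.unitRight₀ P A)
      rw [hL.ν0₀]
      refine congrArg (_ ≫ ·) (congrArg (_ ≫ ·) ?_)
      refine (𝓐.F.v_comp _ _ _ _).trans ?_
      rw [Category.id_comp, Category.comp_id]
      rfl
    unitL := fun P A => by
      refine Eq.trans ?_ (L.unitLeft₀ P A)
      rw [hL.ν0₀]
      refine congrArg (_ ≫ ·) (congrArg (_ ≫ ·) ?_)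
      refine (𝓐.F.v_comp _ _ _ _).trans ?_
      rw [Category.id_comp, Category.comp_id]
      rfl
    β2 := fun P Q A R S B => by
      rw [← Ψ.mid₀_eq]
      exact hL.β2₀ P Q A R S B
    ν2 := hL.ν2₀ }

lemma isMonoidal₁ {L : LaxMonoidal 𝓐 𝓓} {Ψ : VBraiding 𝓜} (hL : L.HasTrivialCocycles Ψ) :
    @CatLaxAction.IsMonoidal (HArrow M) _ 𝓜.monoidal₁ Ψ.braided₁ (HArrow D) _ 𝓓.monoidal₁ 𝓐.act₁
      (fun p f q g => L.m₁ p.hom f.hom q.hom g.hom) :=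
  let _ := 𝓜.monoidal₁
  let _ := Ψ.braided₁
  let _ := 𝓓.monoidal₁
  { nat₁ := fun p A Q B => by
      have k := L.m₁_naturality p (vid A.hom) (vid Q.hom) (vid B.hom)
      simp only [c_vid] at k
      exact k
    nat₂ := fun P _ _ f Q B => by
      have k := L.m₁_naturality (vid P.hom) f (vid Q.hom) (vid B.hom)
      simp only [c_vid] at k
      exact k
    nat₃ := fun P A _ _ q B => by
      have k := L.m₁_naturality (vid P.hom) (vid A.hom) q (vid B.hom)
      simp only [c_vid] at k
      exact k
    nat₄ := fun P A Q _ _ g => by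
      have k := L.m₁_naturality (vid P.hom) (vid A.hom) (vid Q.hom) g
      simp only [c_vid] at k
      exact k
    assoc := fun P A Q B R C => by
      refine Eq.trans ?_ (L.assoc₁ P.hom A.hom Q.hom B.hom R.hom C.hom)
      refine congrArg (_ ≫ᵥ ·) (congrArg (_ ≫ᵥ ·) ?_)
      refine (𝓐.F.c_vcomp _ _ _ _).trans ?_
      rw [vid_vcomp, vcomp_vid]
      rfl
    unitR := fun P A => by
      refine Eq.trans ?_ (L.unitRight₁ P.hom A.hom)
      rw [hL.ν0₁]
      refine congrArg (_ ≫ᵥ ·) (congrArg (_ ≫ᵥ ·) ?_)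
      refine (𝓐.F.c_vcomp _ _ _ _).trans ?_
      rw [vid_vcomp, vcomp_vid]
      rfl
    unitL := fun P A => by
      refine Eq.trans ?_ (L.unitLeft₁ P.hom A.hom)
      rw [hL.ν0₁]
      refine congrArg (_ ≫ᵥ ·) (congrArg (_ ≫ᵥ ·) ?_)
      refine (𝓐.F.c_vcomp _ _ _ _).trans ?_
      rw [vid_vcomp, vcomp_vid]
      rfl
    β2 := fun P Q A R S B => by
      rw [← Ψ.mid₁_eq]
      exact hL.β2₁ P.hom Q.hom A.hom R.hom S.hom B.hom
    ν2 := fun A B => hL.ν2₁ A.hom B.hom }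

end LaxMonoidal

end

/-! ### Reading the strength laws in the two categories, and assembling both directions. -/

section

variable {M : Type u₁} [DoubleCategory.{z₁, w₁, v₁, u₁} M] {𝓜 : VMonoidal M} {D : Type u₂}
  [DoubleCategory.{z₂, w₂, v₂, u₂} D] {𝓓 : VMonoidal D} {𝓐 : LaxAction 𝓜 D}

lemma IsCommutative.isBistrongCommutative₀ {Ψ : VBraiding 𝓜} {t : LeftStrength 𝓐 𝓓}
    {s : RightStrength 𝓐 𝓓} (hq : IsBistrong t s) (hc : IsCommutative Ψ t s) :
    @CatLaxAction.IsBistrongCommutative M _ 𝓜.monoidal₀ Ψ.braided₀ D _ 𝓓.monoidal₀ 𝓐.act₀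
      t.t₀ s.s₀ :=
  let _ := 𝓜.monoidal₀
  let _ := Ψ.braided₀
  let _ := 𝓓.monoidal₀
  { t_nat₁ := fun p A B => by
      have k := t.t₀_naturality p (𝟙 A) (𝟙 B)
      simp only [v_id] at k
      exact k
    t_nat₂ := fun P _ _ f B => by
      have k := t.t₀_naturality (𝟙 P) f (𝟙 B)
      simp only [v_id] at k
      exact k
    t_nat₃ := fun P A _ _ g => t.t₀_naturality (𝟙 P) (𝟙 A) g
    s_nat₁ := fun p A B => by
      have k := s.s₀_naturality p (𝟙 A) (𝟙 B)
      simp only [v_id] at k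
      exact k
    s_nat₂ := fun P _ _ f B => s.s₀_naturality (𝟙 P) f (𝟙 B)
    s_nat₃ := fun P A _ _ g => by
      have k := s.s₀_naturality (𝟙 P) (𝟙 A) g
      simp only [v_id] at k
      exact k
    tx := t.x₀
    ty := t.y₀
    tw := t.w₀
    tz := t.z₀
    sx := s.x₀
    sy := s.y₀
    sw := s.w₀
    sz := s.z₀
    q := hq.q₀
    c := hc.c₀ }

lemma IsCommutative.isBistrongCommutative₁ {Ψ : VBraiding 𝓜} {t : LeftStrength 𝓐 𝓓}
    {s : RightStrength 𝓐 𝓓} (hq : IsBistrong t s) (hc : IsCommutative Ψ t s) :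
    @CatLaxAction.IsBistrongCommutative (HArrow M) _ 𝓜.monoidal₁ Ψ.braided₁ (HArrow D) _
      𝓓.monoidal₁ 𝓐.act₁ (fun p f g => t.t₁ p.hom f.hom g.hom)
      (fun p f g => s.s₁ p.hom f.hom g.hom) :=
  let _ := 𝓜.monoidal₁
  let _ := Ψ.braided₁
  let _ := 𝓓.monoidal₁
  { t_nat₁ := fun p A B => by
      have k := t.t₁_naturality p (vid A.hom) (vid B.hom)
      simp only [c_vid] at k
      exact k
    t_nat₂ := fun P _ _ f B => by
      have k := t.t₁_naturality (vid P.hom) f (vid B.hom)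
      simp only [c_vid] at k
      exact k
    t_nat₃ := fun P A _ _ g => t.t₁_naturality (vid P.hom) (vid A.hom) g
    s_nat₁ := fun p A B => by
      have k := s.s₁_naturality p (vid A.hom) (vid B.hom)
      simp only [c_vid] at k
      exact k
    s_nat₂ := fun P _ _ f B => s.s₁_naturality (vid P.hom) f (vid B.hom)
    s_nat₃ := fun P A _ _ g => by
      have k := s.s₁_naturality (vid P.hom) (vid A.hom) g
      simp only [c_vid] at k
      exact k
    tx := fun p f => t.x₁ p.hom f.hom
    ty := fun p f g h => t.y₁ p.hom f.hom g.hom h.hom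
    tw := fun p q f g => t.w₁ p.hom q.hom f.hom g.hom
    tz := fun f g => t.z₁ f.hom g.hom
    sx := fun p f => s.x₁ p.hom f.hom
    sy := fun p f g h => s.y₁ p.hom f.hom g.hom h.hom
    sw := fun p q f g => s.w₁ p.hom q.hom f.hom g.hom
    sz := fun f g => s.z₁ f.hom g.hom
    q := fun p f g h => hq.q₁ p.hom f.hom g.hom h.hom
    c := fun p f q g => hc.c₁ p.hom f.hom q.hom g.hom }

namespace LaxMonoidal

variable {L : LaxMonoidal 𝓐 𝓓} {Ψ : VBraiding 𝓜}

/-- The one-dimensional result applies directly because the components of the constructed strengths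
are definitionally `leftStrengthOf` and `rightStrengthOf` of the components of $F^2$. -/
lemma isBistrongCommutative₀ (hL : L.HasTrivialCocycles Ψ) :
    @CatLaxAction.IsBistrongCommutative M _ 𝓜.monoidal₀ Ψ.braided₀ D _ 𝓓.monoidal₀ 𝓐.act₀
      L.leftStrengthData.t₀ L.rightStrengthData.s₀ :=
  let _ := 𝓜.monoidal₀
  let _ := Ψ.braided₀
  let _ := 𝓓.monoidal₀
  (isMonoidal₀ hL).isBistrongCommutative

lemma isBistrongCommutative₁ (hL : L.HasTrivialCocycles Ψ) :
    @CatLaxAction.IsBistrongCommutative (HArrow M) _ 𝓜.monoidal₁ Ψ.braided₁ (HArrow D) _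
      𝓓.monoidal₁ 𝓐.act₁ (fun p f g => L.leftStrengthData.t₁ p.hom f.hom g.hom)
      (fun p f g => L.rightStrengthData.s₁ p.hom f.hom g.hom) :=
  let _ := 𝓜.monoidal₁
  let _ := Ψ.braided₁
  let _ := 𝓓.monoidal₁
  (isMonoidal₁ hL).isBistrongCommutative

/-- The left strength of a lax monoidal action with trivial cocycles. -/
def leftStrength (hL : L.HasTrivialCocycles Ψ) : LeftStrength 𝓐 𝓓 :=
  letI := 𝓜.monoidal₀
  letI := 𝓜.monoidal₁
  letI := 𝓓.monoidal₀
  letI := 𝓓.monoidal₁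
  letI := Ψ.braided₀
  letI := Ψ.braided₁
  have h₀ := isBistrongCommutative₀ hL
  have h₁ := isBistrongCommutative₁ hL
  { toLeftStrengthData := L.leftStrengthData
    x₀ := h₀.tx
    x₁ := fun p f => h₁.tx ⟨p⟩ ⟨f⟩
    y₀ := h₀.ty
    y₁ := fun p f g h => h₁.ty ⟨p⟩ ⟨f⟩ ⟨g⟩ ⟨h⟩
    w₀ := h₀.tw
    w₁ := fun p q f g => h₁.tw ⟨p⟩ ⟨q⟩ ⟨f⟩ ⟨g⟩
    z₀ := h₀.tz
    z₁ := fun f g => h₁.tz ⟨f⟩ ⟨g⟩ }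

/-- The right strength of a lax monoidal action with trivial cocycles. -/
def rightStrength (hL : L.HasTrivialCocycles Ψ) : RightStrength 𝓐 𝓓 :=
  letI := 𝓜.monoidal₀
  letI := 𝓜.monoidal₁
  letI := 𝓓.monoidal₀
  letI := 𝓓.monoidal₁
  letI := Ψ.braided₀
  letI := Ψ.braided₁
  have h₀ := isBistrongCommutative₀ hL
  have h₁ := isBistrongCommutative₁ hL
  { toRightStrengthData := L.rightStrengthData
    x₀ := h₀.sx
    x₁ := fun p f => h₁.sx ⟨p⟩ ⟨f⟩
    y₀ := h₀.sy
    y₁ := fun p f g h => h₁.sy ⟨p⟩ ⟨f⟩ ⟨g⟩ ⟨h⟩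
    w₀ := h₀.sw
    w₁ := fun p q f g => h₁.sw ⟨p⟩ ⟨q⟩ ⟨f⟩ ⟨g⟩
    z₀ := h₀.sz
    z₁ := fun f g => h₁.sz ⟨f⟩ ⟨g⟩ }

lemma isBistrong (hL : L.HasTrivialCocycles Ψ) :
    IsBistrong (leftStrength hL) (rightStrength hL) :=
  let _ := 𝓜.monoidal₀
  let _ := 𝓜.monoidal₁
  let _ := 𝓓.monoidal₀
  let _ := 𝓓.monoidal₁
  let _ := Ψ.braided₀
  let _ := Ψ.braided₁
  have h₀ := isBistrongCommutative₀ hL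
  have h₁ := isBistrongCommutative₁ hL
  { q₀ := h₀.q
    q₁ := fun p f g h => h₁.q ⟨p⟩ ⟨f⟩ ⟨g⟩ ⟨h⟩ }

lemma isCommutative (hL : L.HasTrivialCocycles Ψ) :
    IsCommutative Ψ (leftStrength hL) (rightStrength hL) :=
  let _ := 𝓜.monoidal₀
  let _ := 𝓜.monoidal₁
  let _ := 𝓓.monoidal₀
  let _ := 𝓓.monoidal₁
  let _ := Ψ.braided₀
  let _ := Ψ.braided₁
  have h₀ := isBistrongCommutative₀ hL
  have h₁ := isBistrongCommutative₁ hL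
  { c₀ := h₀.c
    c₁ := fun p f q g => h₁.c ⟨p⟩ ⟨f⟩ ⟨q⟩ ⟨g⟩ }

end LaxMonoidal

namespace IsCommutative

variable {Ψ : VBraiding 𝓜} {t : LeftStrength 𝓐 𝓓} {s : RightStrength 𝓐 𝓓}

/-- Here too the components of the constructed $F^2$ are definitionally those of `mulOf`. -/
lemma isMonoidal₀ (hq : IsBistrong t s) (hc : IsCommutative Ψ t s) :
    @CatLaxAction.IsMonoidal M _ 𝓜.monoidal₀ Ψ.braided₀ D _ 𝓓.monoidal₀ 𝓐.act₀
      (laxMonoidalDataOf t.toLeftStrengthData s.toRightStrengthData).m₀ :=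
  let _ := 𝓜.monoidal₀
  let _ := Ψ.braided₀
  let _ := 𝓓.monoidal₀
  (isBistrongCommutative₀ hq hc).isMonoidal

lemma isMonoidal₁ (hq : IsBistrong t s) (hc : IsCommutative Ψ t s) :
    @CatLaxAction.IsMonoidal (HArrow M) _ 𝓜.monoidal₁ Ψ.braided₁ (HArrow D) _ 𝓓.monoidal₁ 𝓐.act₁
      (fun p f q g =>
        (laxMonoidalDataOf t.toLeftStrengthData s.toRightStrengthData).m₁
          p.hom f.hom q.hom g.hom) :=
  let _ := 𝓜.monoidal₁
  let _ := Ψ.braided₁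
  let _ := 𝓓.monoidal₁
  (isBistrongCommutative₁ hq hc).isMonoidal

/-- The lax monoidal structure of a bistrong commutative action. -/
def laxMonoidal (hq : IsBistrong t s) (hc : IsCommutative Ψ t s) : LaxMonoidal 𝓐 𝓓 :=
  letI := 𝓜.monoidal₀
  letI := 𝓜.monoidal₁
  letI := 𝓓.monoidal₀
  letI := 𝓓.monoidal₁
  letI := Ψ.braided₀
  letI := Ψ.braided₁
  have h₀ := isMonoidal₀ hq hc
  have h₁ := isMonoidal₁ hq hc
  { toLaxMonoidalData := laxMonoidalDataOf t.toLeftStrengthData s.toRightStrengthData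
    assoc₀ := fun P A Q B R C => by
      refine Eq.trans ?_ (h₀.assoc P A Q B R C)
      refine congrArg (_ ≫ ·) (congrArg (_ ≫ ·) (Eq.trans ?_ (𝓐.F.v_comp _ _ _ _).symm))
      exact congrArg₂ 𝓐.F.v (Category.comp_id _).symm (Category.id_comp _).symm
    assoc₁ := fun p f q g r h => by
      refine Eq.trans ?_ (h₁.assoc ⟨p⟩ ⟨f⟩ ⟨q⟩ ⟨g⟩ ⟨r⟩ ⟨h⟩)
      refine congrArg (_ ≫ᵥ ·) (congrArg (_ ≫ᵥ ·) (Eq.trans ?_ (𝓐.F.c_vcomp _ _ _ _).symm))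
      exact congrArg₂ 𝓐.F.c (vcomp_vid _).symm (vid_vcomp _).symm
    unitRight₀ := fun P A => by
      refine Eq.trans ?_ (h₀.unitR P A)
      refine congrArg (_ ≫ ·) (congrArg (_ ≫ ·) (Eq.trans ?_ (𝓐.F.v_comp _ _ _ _).symm))
      exact congrArg₂ 𝓐.F.v (Category.comp_id _).symm (Category.id_comp _).symm
    unitRight₁ := fun p f => by
      refine Eq.trans ?_ (h₁.unitR ⟨p⟩ ⟨f⟩)
      refine congrArg (_ ≫ᵥ ·) (congrArg (_ ≫ᵥ ·) (Eq.trans ?_ (𝓐.F.c_vcomp _ _ _ _).symm))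
      exact congrArg₂ 𝓐.F.c (vcomp_vid _).symm (vid_vcomp _).symm
    unitLeft₀ := fun P A => by
      refine Eq.trans ?_ (h₀.unitL P A)
      refine congrArg (_ ≫ ·) (congrArg (_ ≫ ·) (Eq.trans ?_ (𝓐.F.v_comp _ _ _ _).symm))
      exact congrArg₂ 𝓐.F.v (Category.comp_id _).symm (Category.id_comp _).symm
    unitLeft₁ := fun p f => by
      refine Eq.trans ?_ (h₁.unitL ⟨p⟩ ⟨f⟩)
      refine congrArg (_ ≫ᵥ ·) (congrArg (_ ≫ᵥ ·) (Eq.trans ?_ (𝓐.F.c_vcomp _ _ _ _).symm))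
      exact congrArg₂ 𝓐.F.c (vcomp_vid _).symm (vid_vcomp _).symm }

lemma hasTrivialCocycles (hq : IsBistrong t s) (hc : IsCommutative Ψ t s) :
    (laxMonoidal hq hc).HasTrivialCocycles Ψ :=
  let _ := 𝓜.monoidal₀
  let _ := 𝓜.monoidal₁
  let _ := 𝓓.monoidal₀
  let _ := 𝓓.monoidal₁
  let _ := Ψ.braided₀
  let _ := Ψ.braided₁
  have h₀ := isMonoidal₀ hq hc
  have h₁ := isMonoidal₁ hq hc
  { β2₀ := fun P Q A R S B => by
      rw [Ψ.mid₀_eq]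
      exact h₀.β2 P Q A R S B
    β2₁ := fun p q f r s' g => by
      refine Eq.trans ?_ (h₁.β2 ⟨p⟩ ⟨q⟩ ⟨f⟩ ⟨r⟩ ⟨s'⟩ ⟨g⟩)
      rw [← Ψ.mid₁_eq]
      rfl
    β0₀ := by
      -- With $\iota=\nu_I$ the $\beta^0$ law says that $J\nu_I;\beta_{J,J,I};\lambda_JI$ is
      -- absorbed by $\iota$. Since $\lambda_J=\rho_J$, this map is the identity by the right unit
      -- axiom of the action.
      refine (Category.comp_id _).symm.trans (congrArg (_ ≫ ·) ?_)
      refine (𝓐.act₀.unitR _ _).symm.trans ?_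
      have e : 𝓜.lam₀ 𝓜.I₀ = 𝓜.rho₀ 𝓜.I₀ := MonoidalCategory.unitors_equal (C := M)
      rw [e]
      rfl
    β0₁ := by
      refine (vcomp_vid _).symm.trans (congrArg (_ ≫ᵥ ·) ?_)
      refine (𝓐.act₁.unitR ⟨𝓜.I₁⟩ ⟨𝓓.I₁⟩).symm.trans ?_
      have e : 𝓜.lam₁ 𝓜.I₁ = 𝓜.rho₁ 𝓜.I₁ := MonoidalCategory.unitors_equal (C := HArrow M)
      rw [e]
      rfl
    ν2₀ := h₀.ν2
    ν2₁ := fun f g => h₁.ν2 ⟨f⟩ ⟨g⟩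
    ν0₀ := rfl
    ν0₁ := rfl }

end IsCommutative

end

theorem mainTheorem12 {M : Type u₁} [DoubleCategory.{z₁, w₁, v₁, u₁} M] {D : Type u₂}
    [DoubleCategory.{z₂, w₂, v₂, u₂} D] (𝓜 : VMonoidal M) (Ψ : VBraiding 𝓜) (𝓓 : VMonoidal D)
    (𝓐 : LaxAction 𝓜 D) :
    (∃ L : LaxMonoidal 𝓐 𝓓, L.HasTrivialCocycles Ψ) ↔
      ∃ (t : LeftStrength 𝓐 𝓓) (s : RightStrength 𝓐 𝓓),
        IsBistrong t s ∧ IsCommutative Ψ t s :=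
  ⟨fun ⟨_, hL⟩ => ⟨LaxMonoidal.leftStrength hL, LaxMonoidal.rightStrength hL,
      LaxMonoidal.isBistrong hL, LaxMonoidal.isCommutative hL⟩,
    fun ⟨_, _, hq, hc⟩ => ⟨IsCommutative.laxMonoidal hq hc,
      IsCommutative.hasTrivialCocycles hq hc⟩⟩
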